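/- Let $X$ be a proper CAT(0) space (a proper geodesic metric space whose geodesic triangles are at least as thin as their Euclidean comparison triangles), let $o\in X$ be a base-point and write $\|x\|=d(o,x)$. Let $\kappa:[0,\infty)\to[1,\infty)$ be a sublinear function, i.e. monotone increasing, concave, with $\lim_{t\to\infty}\kappa(t)/t=0$. For $Z\subseteq X$ put $\mathcal N_\kappa(Z,n)=\{x\in X: d(x,Z)\le n\,\kappa(\|x\|)\}$. For $q\ge1$, $Q\ge0$, a $(q,Q)$-quasi-geodesic ray is a continuous $(q,Q)$-quasi-isometric embedding $\beta:[0,\infty)\to X$ with $\beta(0)=o$; a geodesic ray is an isometric embedding with $\beta(0)=o$. Rays are identified with their images where convenient. Two quasi-geodesic rays $\beta,\gamma$ $\kappa$-fellow travel if $\beta\subseteq\mathcal N_\kappa(\gamma,n)$ and $\gamma\subseteq\mathcal N_\kappa(\beta,n')$ for some $n,n'$; this is an equivalence relation. A closed set $Z$ is $\kappa$-contracting if there is a constant $c$ such that for all $x,y\in X$ with $d(x,y)\le d(x,Z)$ one has $\operatorname{diam}(x_Z\cup y_Z)\le c\,\kappa(\|x\|)$, where $x_Z$ is the set of points of $Z$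 nearest to $x$. The $\kappa$-Morse boundary $\partial_\kappa X$ is the set of $\kappa$-fellow travelling classes of $\kappa$-contracting quasi-geodesic rays. Say that $D$ is small compared to $r>0$ if $D\le r/(2\kappa(r))$. For a quasi-geodesic ray $\alpha$ and $r>0$ let $t_r$ be the first time with $\|\alpha(t_r)\|=r$ and let $\alpha|_r=\alpha([0,t_r])$. A gauge for a geodesic ray $b$ is a function $m_b(q,Q)\ge\max(q,Q)$ such that for all $r,n>0$ and every sublinear function $\kappa'$ there is $R>0$ such that for all $q\ge1$, $Q\ge0$ and every $(q,Q)$-quasi-geodesic ray $\eta$ with $m_b(q,Q)$ small compared to $r$: if $d(\eta(t_R),b)\le n\,\kappa'(R)$, then $\eta|_r\subseteq\mathcal N_\kappa(b,m_b(q,Q))$. Theorem. Every class $\mathbf b\in\partial_\kappa X$ contains exactly one geodesic ray $b$, and this ray has a gauge. Choose any gauge $m_b$ for the geodesic ray $b$ of each $\mathbf b\in\partial_\kappa X$, and for $r>0$ let $\mathcal U_\kappa(\mathbf b,r)$ be the set of all $\mathbf a\in\partial_\kappa X$ such that $\alpha|_r\subseteq\mathcal N_\kappa(b,m_b(q,Q))$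 for every $(q,Q)$-quasi-geodesic ray $\alpha\in\mathbf a$ with $m_b(q,Q)$ small compared to $r$. Let $W\subseteq\partial_\kappa X$ be open if for every $\mathbf b\in W$ there is $r>0$ with $\mathcal U_\kappa(\mathbf b,r)\subseteq W$. This is a topology on $\partial_\kappa X$ (the visual topology on quasi-geodesics), in which the sets $\mathcal U_\kappa(\mathbf b,r)$, $r>0$, form a neighbourhood basis of each point $\mathbf b$, and $\partial_\kappa X$ with this topology is metrizable. -/

import Mathlib

open Set Filter Topology
open scoped NNReal

namespace KappaMorse

/-! ### CAT(0) spaces -/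

/-- `γ : [0, l] → X` is a geodesic segment from `p` to `q`, parametrised by arc length
(the values of `γ` outside `[0, l]` are irrelevant). -/
def IsGeodesicSegment {X : Type*} [MetricSpace X] (γ : ℝ → X) (l : ℝ) (p q : X) : Prop :=
  0 ≤ l ∧ γ 0 = p ∧ γ l = q ∧
    ∀ s ∈ Icc (0 : ℝ) l, ∀ t ∈ Icc (0 : ℝ) l, dist (γ s) (γ t) = |s - t|

/-- A metric space is CAT(0) if it is geodesic and its geodesic triangles are at least as thin as
their comparison triangles in the Euclidean plane. In the comparison condition `γ` and `δ` are the
two sides of the triangle issuing from `p`, the triangle `p' q' r'` is the comparison triangle,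
and `x'`, `y'` are the comparison points of `γ s`, `δ t`. -/
structure IsCAT0 (X : Type*) [MetricSpace X] : Prop where
  geodesic : ∀ p q : X, ∃ (γ : ℝ → X) (l : ℝ), IsGeodesicSegment γ l p q
  comparison : ∀ (p q r : X) (γ δ : ℝ → X) (l₁ l₂ : ℝ),
    IsGeodesicSegment γ l₁ p q → IsGeodesicSegment δ l₂ p r →
    ∀ p' q' r' : EuclideanSpace ℝ (Fin 2),
      dist p' q' = dist p q → dist p' r' = dist p r → dist q' r' = dist q r →
    ∀ s ∈ Icc (0 : ℝ) l₁, ∀ t ∈ Icc (0 : ℝ) l₂,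
    ∀ x' ∈ segment ℝ p' q', ∀ y' ∈ segment ℝ p' r',
      dist p' x' = s → dist p' y' = t → dist (γ s) (δ t) ≤ dist x' y'

/-! ### Sublinear functions -/

/-- A function `κ : [0, ∞) → [1, ∞)` that is monotone increasing, concave and sublinear
(values at negative reals are irrelevant). -/
structure SublinearFn where
  toFun : ℝ → ℝ
  one_le : ∀ t, 0 ≤ t → 1 ≤ toFun t
  mono : MonotoneOn toFun (Ici 0)
  concave : ConcaveOn ℝ (Ici 0) toFun
  sublinear : Tendsto (fun t => toFun t / t) atTop (𝓝 0)

instance : CoeFun SublinearFn (fun _ => ℝ → ℝ) := ⟨SublinearFn.toFun⟩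

theorem SublinearFn.mul_le (κ : SublinearFn) {a t : ℝ} (ha : 1 ≤ a) (ht : 0 ≤ t) :
    κ (a * t) ≤ a * κ t := by
  have ha0 : 0 < a := by linarith
  have hat : a * t ∈ Ici (0 : ℝ) := mem_Ici.2 (by positivity)
  have h00 : (0 : ℝ) ∈ Ici (0 : ℝ) := mem_Ici.2 le_rfl
  have hi : 0 ≤ a⁻¹ := by positivity
  have hi' : 0 ≤ 1 - a⁻¹ := by linarith [inv_le_one_of_one_le₀ ha]
  have h := κ.concave.2 hat h00 hi hi' (by ring)
  have h0 := κ.one_le 0 le_rfl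
  have e : a⁻¹ * (a * t) = t := by field_simp
  simp only [smul_eq_mul, mul_zero, add_zero, e] at h
  have h1 : 0 ≤ (1 - a⁻¹) * κ 0 :=
    mul_nonneg (by linarith [inv_le_one_of_one_le₀ ha]) (by linarith)
  have h2 : a⁻¹ * κ (a * t) ≤ κ t := by linarith
  calc κ (a * t) = a * (a⁻¹ * κ (a * t)) := by field_simp
    _ ≤ a * κ t := by gcongr

/-- `D` is small compared to the radius `r`. -/
def IsSmall (κ : SublinearFn) (D r : ℝ) : Prop := D ≤ r / (2 * κ r)

theorem IsSmall.mono {κ : SublinearFn} {D r r' : ℝ} (h : IsSmall κ D r) (hr : 0 < r)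
    (hrr' : r ≤ r') : IsSmall κ D r' := by
  have hr' : 0 < r' := by linarith
  have h1 := κ.one_le r hr.le
  have h2 := κ.one_le r' hr'.le
  have h3 := κ.mul_le (a := r' / r) (t := r) ((one_le_div hr).2 hrr') hr.le
  rw [div_mul_cancel₀ _ hr.ne'] at h3
  refine le_trans h ?_
  rw [div_le_div_iff₀ (by positivity) (by positivity)]
  have h4 : r * κ r' ≤ r' * κ r := by
    calc r * κ r' ≤ r * (r' / r * κ r) := by gcongr
      _ = r' * κ r := by field_simp
  linarith

/-- The `(κ, n)`-neighbourhood of a set `Z`, with respect to the base-point `o`. -/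
def nbhd {X : Type*} [MetricSpace X] (κ : SublinearFn) (o : X) (Z : Set X) (n : ℝ) : Set X :=
  {x | Metric.infDist x Z ≤ n * κ (dist o x)}

/-! ### Quasi-geodesic rays -/

/-- `β : [0, ∞) → X` is a `(q, Q)`-quasi-geodesic ray starting from `o`: a continuous
`(q, Q)`-quasi-isometric embedding with `β 0 = o`. -/
structure IsQuasiGeodesicRay {X : Type*} [MetricSpace X] (o : X) (q Q : ℝ) (β : ℝ≥0 → X) :
    Prop where
  one_le : 1 ≤ q
  nonneg : 0 ≤ Q
  continuous : Continuous β
  base : β 0 = o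
  lower : ∀ s t : ℝ≥0, 1 / q * dist s t - Q ≤ dist (β s) (β t)
  upper : ∀ s t : ℝ≥0, dist (β s) (β t) ≤ q * dist s t + Q

/-- The quasi-geodesic rays of `X` starting from `o`, with arbitrary constants. -/
def QuasiGeodesicRay {X : Type*} [MetricSpace X] (o : X) : Type _ :=
  {β : ℝ≥0 → X // ∃ q Q : ℝ, IsQuasiGeodesicRay o q Q β}

/-- A geodesic ray is an isometric embedding of `[0, ∞)`. -/
def QuasiGeodesicRay.IsGeodesic {X : Type*} [MetricSpace X] {o : X} (b : QuasiGeodesicRay o) :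
    Prop := Isometry b.1

/-- `β` and `γ` `κ`-fellow travel each other. -/
def FellowTravel {X : Type*} [MetricSpace X] (κ : SublinearFn) (o : X)
    (β γ : QuasiGeodesicRay o) : Prop :=
  (∃ n : ℝ, range β.1 ⊆ nbhd κ o (range γ.1) n) ∧ (∃ n : ℝ, range γ.1 ⊆ nbhd κ o (range β.1) n)

theorem SublinearFn.add_mul_le (κ : SublinearFn) {a t : ℝ} (ha : 0 ≤ a) (ht : 0 ≤ t) :
    κ (t + a * κ t) ≤ (1 + a * κ 1) * κ 1 * κ t := by
  have h1 := κ.one_le 1 zero_le_one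
  have hκt := κ.one_le t ht
  have hA : 1 ≤ 1 + a * κ 1 := by
    have : 0 ≤ a * κ 1 := by positivity
    linarith
  have hu : 0 ≤ t + a * κ t := by positivity
  rcases le_total 1 t with h | h
  · have h2 : κ t ≤ t * κ 1 := by simpa using κ.mul_le h zero_le_one
    have h3 : t + a * κ t ≤ (1 + a * κ 1) * t := by nlinarith
    calc κ (t + a * κ t) ≤ κ ((1 + a * κ 1) * t) :=
          κ.mono hu (mem_Ici.2 (by positivity)) h3
      _ ≤ (1 + a * κ 1) * κ t := κ.mul_le hA ht
      _ ≤ (1 + a * κ 1) * κ 1 * κ t := by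
          gcongr
          exact le_mul_of_one_le_right (by linarith) h1
  · have h2 : κ t ≤ κ 1 := κ.mono ht (mem_Ici.2 zero_le_one) h
    have h3 : t + a * κ t ≤ (1 + a * κ 1) * 1 := by nlinarith
    calc κ (t + a * κ t) ≤ κ ((1 + a * κ 1) * 1) :=
          κ.mono hu (mem_Ici.2 (by linarith)) h3
      _ ≤ (1 + a * κ 1) * κ 1 := κ.mul_le hA zero_le_one
      _ ≤ (1 + a * κ 1) * κ 1 * κ t := le_mul_of_one_le_right (by positivity) hκt

theorem nbhd_trans {X : Type*} [MetricSpace X] (κ : SublinearFn) (o : X) {Z₁ Z₂ Z₃ : Set X}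
    (hne₂ : Z₂.Nonempty)
    (h₁ : ∃ n : ℝ, Z₁ ⊆ nbhd κ o Z₂ n) (h₂ : ∃ n : ℝ, Z₂ ⊆ nbhd κ o Z₃ n) :
    ∃ n : ℝ, Z₁ ⊆ nbhd κ o Z₃ n := by
  obtain ⟨n, hn⟩ := h₁
  obtain ⟨m, hm⟩ := h₂
  have hκ1 := κ.one_le 1 zero_le_one
  refine ⟨(|n| + 1) + (|m| + 1) * ((1 + (|n| + 1) * κ 1) * κ 1), fun x hx => ?_⟩
  have hκx := κ.one_le (dist o x) dist_nonneg
  have hx1 : Metric.infDist x Z₂ ≤ n * κ (dist o x) := hn hx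
  have hx2 : Metric.infDist x Z₂ < (|n| + 1) * κ (dist o x) := by
    nlinarith [le_abs_self n]
  obtain ⟨y, hy, hxy⟩ := (Metric.infDist_lt_iff hne₂).1 hx2
  have hκy := κ.one_le (dist o y) dist_nonneg
  have hy1 : Metric.infDist y Z₃ ≤ m * κ (dist o y) := hm hy
  have hoy : dist o y ≤ dist o x + (|n| + 1) * κ (dist o x) := by
    linarith [dist_triangle o x y]
  have hκ2 : κ (dist o y) ≤ (1 + (|n| + 1) * κ 1) * κ 1 * κ (dist o x) :=
    (κ.mono (mem_Ici.2 dist_nonneg) (mem_Ici.2 (by positivity)) hoy).trans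
      (κ.add_mul_le (by positivity) dist_nonneg)
  have hy2 : m * κ (dist o y) ≤
      (|m| + 1) * ((1 + (|n| + 1) * κ 1) * κ 1 * κ (dist o x)) := by
    calc m * κ (dist o y) ≤ (|m| + 1) * κ (dist o y) := by
          nlinarith [le_abs_self m]
      _ ≤ _ := by gcongr
  have := Metric.infDist_le_infDist_add_dist (s := Z₃) (x := x) (y := y)
  change Metric.infDist x Z₃ ≤ _
  linarith

theorem fellowTravel_equivalence {X : Type*} [MetricSpace X] (κ : SublinearFn) (o : X) :
    Equivalence (FellowTravel κ o) := by
  have hrefl : ∀ β : QuasiGeodesicRay o, ∃ n : ℝ, range β.1 ⊆ nbhd κ o (range β.1) n := by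
    refine fun β => ⟨0, fun x hx => ?_⟩
    change Metric.infDist x (range β.1) ≤ _
    rw [Metric.infDist_zero_of_mem hx, zero_mul]
  exact ⟨fun β => ⟨hrefl β, hrefl β⟩, fun h => ⟨h.2, h.1⟩, fun {β γ δ} h h' =>
    ⟨nbhd_trans κ o (range_nonempty _) h.1 h'.1,
      nbhd_trans κ o (range_nonempty _) h'.2 h.2⟩⟩

/-- `κ`-fellow travelling, as an equivalence relation on quasi-geodesic rays. -/
def fellowTravelSetoid {X : Type*} [MetricSpace X] (κ : SublinearFn) (o : X) :
    Setoid (QuasiGeodesicRay o) := ⟨FellowTravel κ o, fellowTravel_equivalence κ o⟩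

/-! ### The boundary as a set -/

/-- The set of nearest points to `x` in `Z`. -/
def nearestPoints {X : Type*} [MetricSpace X] (Z : Set X) (x : X) : Set X :=
  {z ∈ Z | dist x z = Metric.infDist x Z}

/-- `Z` is `κ`-contracting. -/
def IsContracting {X : Type*} [MetricSpace X] (κ : SublinearFn) (o : X) (Z : Set X) : Prop :=
  ∃ c : ℝ, ∀ x y : X, dist x y ≤ Metric.infDist x Z →
    Metric.diam (nearestPoints Z x ∪ nearestPoints Z y) ≤ c * κ (dist o x)

/-- The `κ`-Morse boundary: the `κ`-fellow travelling classes of `κ`-contracting quasi-geodesic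
rays starting from `o`. -/
def Boundary {X : Type*} [MetricSpace X] (κ : SublinearFn) (o : X) : Type _ :=
  {b : Quotient (fellowTravelSetoid κ o) //
    ∃ β : QuasiGeodesicRay o, IsContracting κ o (range β.1) ∧
      Quotient.mk (fellowTravelSetoid κ o) β = b}

/-- The quasi-geodesic ray `β` belongs to the class `b`. -/
def Boundary.Contains {X : Type*} [MetricSpace X] {κ : SublinearFn} {o : X} (b : Boundary κ o)
    (β : QuasiGeodesicRay o) : Prop := Quotient.mk (fellowTravelSetoid κ o) β = b.1

/-! ### Gauges, neighbourhoods and the topology -/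

/-- The first time at which `α` has distance `r` to `o`. -/
noncomputable def firstTime {X : Type*} [MetricSpace X] (o : X) (α : ℝ≥0 → X) (r : ℝ) : ℝ≥0 :=
  sInf {t | dist o (α t) = r}

/-- The initial piece `α|_r` of `α`, up to the first time it has distance `r` to `o`,
considered as a subset of `X`. -/
def initialPiece {X : Type*} [MetricSpace X] (o : X) (α : ℝ≥0 → X) (r : ℝ) : Set X :=
  α '' Icc 0 (firstTime o α r)

/-- `m` is a (strong) `κ`-Morse gauge for `Z`: whenever a quasi-geodesic ray, with constants whose
gauge is small compared to `r`, is sublinearly close to `Z` at a sufficiently large radius `R`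
(depending on `r` and on the sublinear closeness only), it is in the `κ`-neighbourhood of `Z` of
size given by the gauge up to the radius `r`. -/
def IsGauge {X : Type*} [MetricSpace X] (κ : SublinearFn) (o : X) (Z : Set X) (m : ℝ → ℝ → ℝ) :
    Prop :=
  (∀ q Q : ℝ, 1 ≤ q → 0 ≤ Q → max q Q ≤ m q Q) ∧
  ∀ (r n : ℝ) (κ' : SublinearFn), 0 < r → 0 < n → ∃ R : ℝ, 0 < R ∧
    ∀ (q Q : ℝ) (η : ℝ≥0 → X), IsQuasiGeodesicRay o q Q η → IsSmall κ (m q Q) r →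
      Metric.infDist (η (firstTime o η R)) Z ≤ n * κ' R →
      initialPiece o η r ⊆ nbhd κ o Z (m q Q)

/-- `m` assigns to each point of the boundary a gauge of the geodesic ray in that class. -/
def IsGaugeFamily {X : Type*} [MetricSpace X] {κ : SublinearFn} {o : X}
    (m : Boundary κ o → ℝ → ℝ → ℝ) : Prop :=
  ∀ (b : Boundary κ o) (β : QuasiGeodesicRay o), β.IsGeodesic → b.Contains β →
    IsGauge κ o (range β.1) (m b)

/-- The set `U_κ(b, r)`: the points `a` such that for every `(q, Q)`-quasi-geodesic ray `α` in `a`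
with `m_b(q, Q)` small compared to `r`, the piece `α|_r` is in the `(κ, m_b(q, Q))`-neighbourhood
of the geodesic ray `β` in the class `b`. -/
def U {X : Type*} [MetricSpace X] {κ : SublinearFn} {o : X} (m : Boundary κ o → ℝ → ℝ → ℝ)
    (b : Boundary κ o) (r : ℝ) : Set (Boundary κ o) :=
  {a | ∀ β : QuasiGeodesicRay o, β.IsGeodesic → b.Contains β →
    ∀ (q Q : ℝ) (α : QuasiGeodesicRay o), IsQuasiGeodesicRay o q Q α.1 → a.Contains α →
      IsSmall κ (m b q Q) r → initialPiece o α.1 r ⊆ nbhd κ o (range β.1) (m b q Q)}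

theorem firstTime_mono {X : Type*} [MetricSpace X] {o : X} {q Q : ℝ} {α : ℝ≥0 → X}
    (hα : IsQuasiGeodesicRay o q Q α) {r r' : ℝ} (hr : 0 ≤ r) (hrr' : r ≤ r') :
    firstTime o α r ≤ firstTime o α r' := by
  have hcont : Continuous fun t => dist o (α t) := continuous_const.dist hα.continuous
  have hq : 0 < q := by linarith [hα.one_le]
  have hQ := hα.nonneg
  have h0 : dist o (α 0) = 0 := by rw [hα.base, dist_self]
  have hne : {t | dist o (α t) = r'}.Nonempty := by
    have hT : 0 ≤ q * (r' + Q) := by have := hr.trans hrr'; positivity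
    obtain ⟨T, hTe⟩ : ∃ T : ℝ≥0, (T : ℝ) = q * (r' + Q) := ⟨Real.toNNReal _, Real.coe_toNNReal _ hT⟩
    have h := hα.lower 0 T
    have hd : dist (0 : ℝ≥0) T = q * (r' + Q) := by
      rw [NNReal.dist_eq, NNReal.coe_zero, zero_sub, abs_neg, hTe, abs_of_nonneg hT]
    have e : 1 / q * (q * (r' + Q)) = r' + Q := by field_simp
    rw [hd, e, hα.base] at h
    obtain ⟨t, -, ht⟩ := intermediate_value_Icc (zero_le (a := T))
      hcont.continuousOn (show r' ∈ Icc (dist o (α 0)) (dist o (α T)) from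
        ⟨by rw [h0]; linarith, by linarith⟩)
    exact ⟨t, ht⟩
  have hmem : dist o (α (firstTime o α r')) = r' :=
    (isClosed_singleton.preimage hcont).csInf_mem hne (OrderBot.bddBelow _)
  obtain ⟨t, ht, htr⟩ := intermediate_value_Icc (zero_le (a := firstTime o α r'))
    hcont.continuousOn (show r ∈ Icc _ _ from ⟨by rw [h0]; exact hr, by rw [hmem]; exact hrr'⟩)
  have hle : firstTime o α r ≤ t := csInf_le (OrderBot.bddBelow _) htr
  exact hle.trans ht.2

theorem U_anti {X : Type*} [MetricSpace X] {κ : SublinearFn} {o : X}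
    (m : Boundary κ o → ℝ → ℝ → ℝ) (b : Boundary κ o) {r r' : ℝ} (hr : 0 < r) (hrr' : r ≤ r') :
    U m b r' ⊆ U m b r := by
  intro a ha β hβ hb q Q α hα haα hs
  exact (image_mono (Icc_subset_Icc_right (firstTime_mono hα hr.le hrr'))).trans
    (ha β hβ hb q Q α hα haα (hs.mono hr hrr'))

/-- The visual topology on quasi-geodesics: `W` is open if for every `b ∈ W` there is `r > 0`
with `U_κ(b, r) ⊆ W`. -/
@[reducible] def visualTopology {X : Type*} [MetricSpace X] {κ : SublinearFn} {o : X}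
    (m : Boundary κ o → ℝ → ℝ → ℝ) : TopologicalSpace (Boundary κ o) where
  IsOpen W := ∀ b ∈ W, ∃ r : ℝ, 0 < r ∧ U m b r ⊆ W
  isOpen_univ := fun _ _ => ⟨1, one_pos, subset_univ _⟩
  isOpen_inter := by
    rintro V W hV hW b ⟨hbV, hbW⟩
    obtain ⟨r, hr, h⟩ := hV b hbV
    obtain ⟨r', hr', h'⟩ := hW b hbW
    exact ⟨max r r', lt_max_of_lt_left hr, subset_inter
      ((U_anti m b hr (le_max_left _ _)).trans h) ((U_anti m b hr' (le_max_right _ _)).trans h')⟩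
  isOpen_sUnion := by
    rintro S hS b ⟨W, hW, hb⟩
    obtain ⟨r, hr, h⟩ := hS W hW b hb
    exact ⟨r, hr, h.trans (subset_sUnion_of_mem hW)⟩

end KappaMorse

namespace KappaMorse

/-! ### Sublinear functions -/

namespace SublinearFn

variable (κ : SublinearFn)

/-! The geometric input is that nearest-point projection to a contracting set Z moves slowly along a
quasi-geodesic that stays far from Z: each ball disjoint from Z has a projection of size O(κ). A
long excursion would therefore have nearly coincident projections of its endpoints, contradicting
the lower quasi-geodesic bound. Hence an excursion that returns has length O(κ), and one that never
returns ends at linear distance from Z (`exists_infDist_le_of_return`, `exists_no_escape`). Together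
these make Z strongly Morse (`IsContracting.exists_gauge`). Sublinearity of κ enters by absorption:
the radius may grow linearly with the length of the excursion, but κ of that radius costs only a
small fraction of the length.

A geodesic ray in a class arises as a limit of geodesic segments to points of a contracting
representative. A gauge passes to it because the two sets fellow travel, and it is unique because
distances between geodesic rays from o are convex, while fellow travelling bounds them sublinearly.

For the topology everything rests on surgery (`IsCAT0.exists_surgery`): a quasi-geodesic ray η that
is close at radius R to a geodesic ray α can be made to follow α eventually, with controlled
constants and with a long initial piece unchanged. If the class of α lies in U(b, r'), the
redirected ray is close to b at a fixed radius, hence so is η, and the gauge of b controls η up to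
radius r (`IsGaugeFamily.exists_redirect`). No single pair of constants has to be tracked: smallness
of the gauge with respect to r forces q, Q ≤ r, so every relevant ray is a (P, P)-quasi-geodesic
with P = max 1 r.

The redirection principle gives both the neighbourhood basis and regularity. Finite subsets of a
countable dense set of X give second countability, uniqueness of geodesics gives T0, and Urysohn's
metrization theorem finishes the proof. -/

theorem pos {t : ℝ} (ht : 0 ≤ t) : 0 < κ t := by linarith [κ.one_le t ht]

/-- Concavity and positivity give a κ(a+b) ≤ (a+b) κ(a). Adding the mirror inequality and dividing
by a+b yields subadditivity. -/
theorem add_le {a b : ℝ} (ha : 0 ≤ a) (hb : 0 ≤ b) : κ (a + b) ≤ κ a + κ b := by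
  have key : ∀ a b : ℝ, 0 ≤ a → 0 ≤ b → a * κ (a + b) ≤ (a + b) * κ a := by
    intro a b ha hb
    rcases ha.eq_or_lt with rfl | ha
    · have := κ.pos le_rfl
      simp only [zero_mul, zero_add]
      positivity
    · have h := κ.mul_le (a := (a + b) / a) (t := a) ((one_le_div ha).2 (by linarith)) ha.le
      rw [div_mul_cancel₀ _ ha.ne'] at h
      calc a * κ (a + b) ≤ a * ((a + b) / a * κ a) := by gcongr
        _ = (a + b) * κ a := by field_simp
  have h1 := key a b ha hb
  have h2 := key b a hb ha
  rw [add_comm b a] at h2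
  rcases (add_nonneg ha hb).eq_or_lt with h | h
  · have : b = 0 := by linarith
    subst this
    rw [add_zero]
    linarith [κ.pos le_rfl]
  · refine le_of_mul_le_mul_left ?_ h
    linarith

theorem eventually_mul_le (n : ℝ) {ε : ℝ} (hε : 0 < ε) : ∀ᶠ t in atTop, n * κ t ≤ ε * t := by
  have h : ∀ᶠ t in atTop, κ t / t < ε / (|n| + 1) :=
    κ.sublinear.eventually_lt_const (by positivity)
  filter_upwards [h, eventually_gt_atTop 0] with t ht ht0
  have hκ := κ.pos ht0.le
  rw [div_lt_div_iff₀ ht0 (by positivity)] at ht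
  nlinarith [le_abs_self n]

/-- This is the absorption device: κ of a quantity linear in an unknown length M costs at most a
small multiple of M plus a constant. -/
theorem exists_le_mul_add {ε : ℝ} (hε : 0 < ε) :
    ∃ C : ℝ, 0 ≤ C ∧ ∀ t, 0 ≤ t → κ t ≤ ε * t + C := by
  obtain ⟨t₀, h⟩ := eventually_atTop.1 (κ.eventually_mul_le 1 hε)
  have hm : (0 : ℝ) ≤ max t₀ 0 := le_max_right _ _
  refine ⟨κ (max t₀ 0), (κ.pos hm).le, fun t ht => ?_⟩
  rcases le_total t (max t₀ 0) with h' | h'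
  · have := κ.mono (mem_Ici.2 ht) (mem_Ici.2 hm) h'
    have : 0 ≤ ε * t := by positivity
    linarith
  · have := h t ((le_max_left _ _).trans h')
    linarith [κ.pos hm]

theorem eventually_isSmall (D : ℝ) : ∀ᶠ r in atTop, IsSmall κ D r := by
  filter_upwards [κ.eventually_mul_le (2 * D) one_pos, eventually_gt_atTop 0] with r hr hr0
  have := κ.pos hr0.le
  rw [IsSmall, le_div_iff₀ (by positivity)]
  linarith

/-- A concave function may jump at the endpoint 0, so continuity on all of [0, ∞) is available only
after a shift. -/
theorem continuousOn_add_one : ContinuousOn (fun t => κ (t + 1)) (Ici 0) := by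
  have h := κ.concave.continuousOn_interior
  rw [interior_Ici] at h
  exact h.comp (by fun_prop) fun t ht => by
    have : (0 : ℝ) ≤ t := ht
    exact mem_Ioi.2 (by linarith)

end SublinearFn

/-! ### Quasi-geodesic rays -/

section Rays

variable {X : Type*} [MetricSpace X] {o : X} {q Q : ℝ} {α : ℝ≥0 → X}

theorem IsQuasiGeodesicRay.mono (h : IsQuasiGeodesicRay o q Q α) {q' Q' : ℝ} (hq : q ≤ q')
    (hQ : Q ≤ Q') : IsQuasiGeodesicRay o q' Q' α := by
  have h1 := h.one_le
  refine ⟨h1.trans hq, h.nonneg.trans hQ, h.continuous, h.base, fun s t => ?_, fun s t => ?_⟩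
  · have h2 : 1 / q' * dist s t ≤ 1 / q * dist s t := by
      gcongr
    linarith [h.lower s t]
  · have h2 : q * dist s t ≤ q' * dist s t := by gcongr
    linarith [h.upper s t]

theorem IsQuasiGeodesicRay.dist_mul_sub_le (h : IsQuasiGeodesicRay o q Q α) (s t : ℝ≥0) :
    dist s t ≤ q * (dist (α s) (α t) + Q) := by
  have h1 := h.one_le
  have h2 := h.lower s t
  have h3 : q * (1 / q * dist s t) = dist s t := by field_simp
  nlinarith

theorem nnreal_dist_zero (t : ℝ≥0) : dist 0 t = (t : ℝ) := by
  rw [NNReal.dist_eq, NNReal.coe_zero, zero_sub, abs_neg, NNReal.abs_eq]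

theorem IsQuasiGeodesicRay.exists_dist_eq (h : IsQuasiGeodesicRay o q Q α) {r : ℝ} {t : ℝ≥0}
    (hr : 0 ≤ r) (ht : r ≤ dist o (α t)) : ∃ s ≤ t, dist o (α s) = r := by
  have hcont : Continuous fun t => dist o (α t) := continuous_const.dist h.continuous
  have h0 : dist o (α 0) = 0 := by rw [h.base, dist_self]
  obtain ⟨s, hs, hsr⟩ := intermediate_value_Icc (zero_le (a := t)) hcont.continuousOn
    (show r ∈ Icc (dist o (α 0)) (dist o (α t)) from ⟨by rw [h0]; exact hr, ht⟩)
  exact ⟨s, hs.2, hsr⟩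

theorem IsQuasiGeodesicRay.firstTime_le (h : IsQuasiGeodesicRay o q Q α) {r : ℝ} {t : ℝ≥0}
    (hr : 0 ≤ r) (ht : r ≤ dist o (α t)) : firstTime o α r ≤ t := by
  obtain ⟨s, hs, hsr⟩ := h.exists_dist_eq hr ht
  have h1 : firstTime o α r ≤ s := csInf_le (OrderBot.bddBelow _) hsr
  exact h1.trans hs

theorem IsQuasiGeodesicRay.dist_firstTime (h : IsQuasiGeodesicRay o q Q α) {r : ℝ}
    (hr : 0 ≤ r) : dist o (α (firstTime o α r)) = r := by
  have hcont : Continuous fun t => dist o (α t) := continuous_const.dist h.continuous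
  have hq := h.one_le
  have hQ := h.nonneg
  have hne : {t | dist o (α t) = r}.Nonempty := by
    have hT : 0 ≤ q * (r + Q) := by positivity
    have h1 := h.dist_mul_sub_le 0 (Real.toNNReal (q * (r + Q)))
    rw [nnreal_dist_zero, Real.coe_toNNReal _ hT, h.base] at h1
    have h2 := le_of_mul_le_mul_left h1 (by linarith)
    obtain ⟨s, -, hs⟩ := h.exists_dist_eq hr (show r ≤ dist o _ by linarith)
    exact ⟨s, hs⟩
  exact (isClosed_singleton.preimage hcont).csInf_mem hne (OrderBot.bddBelow _)

theorem IsQuasiGeodesicRay.dist_le_of_le_firstTime (h : IsQuasiGeodesicRay o q Q α) {r : ℝ}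
    {t : ℝ≥0} (hr : 0 ≤ r) (ht : t ≤ firstTime o α r) : dist o (α t) ≤ r := by
  by_contra! hlt
  have h1 := h.firstTime_le hr hlt.le
  have h2 : t = firstTime o α r := le_antisymm ht h1
  rw [h2, h.dist_firstTime hr] at hlt
  exact lt_irrefl _ hlt

theorem IsQuasiGeodesicRay.firstTime_eq_of_eqOn (h : IsQuasiGeodesicRay o q Q α) {q' Q' : ℝ}
    {ρ : ℝ≥0 → X} (hρ : IsQuasiGeodesicRay o q' Q' ρ) {t : ℝ≥0} (he : EqOn ρ α (Iic t)) {r : ℝ}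
    (hr : 0 ≤ r) (ht : r ≤ dist o (α t)) : firstTime o ρ r = firstTime o α r := by
  have h1 : firstTime o α r ≤ t := h.firstTime_le hr ht
  have h2 : firstTime o ρ r ≤ t := hρ.firstTime_le hr (by rw [he (mem_Iic.2 le_rfl)]; exact ht)
  refine le_antisymm (hρ.firstTime_le hr ?_) (h.firstTime_le hr ?_)
  · rw [he h1, h.dist_firstTime hr]
  · rw [← he h2, hρ.dist_firstTime hr]

theorem IsQuasiGeodesicRay.isClosed_range [ProperSpace X] (h : IsQuasiGeodesicRay o q Q α) :
    IsClosed (range α) := by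
  have hq : 0 < q := by linarith [h.one_le]
  refine (isProperMap_iff_tendsto_cocompact.2 ⟨h.continuous, ?_⟩).isClosedMap.isClosed_range
  refine tendsto_cocompact_of_tendsto_dist_comp_atTop o ?_
  have h1 : Tendsto (fun t : ℝ≥0 => dist t 0) (cocompact ℝ≥0) atTop :=
    tendsto_dist_right_cocompact_atTop 0
  have h2 : Tendsto (fun t : ℝ≥0 => 1 / q * dist t 0 - Q) (cocompact ℝ≥0) atTop :=
    tendsto_atTop_add_const_right _ _ (h1.const_mul_atTop (by positivity))
  refine tendsto_atTop_mono (fun t => ?_) h2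
  have h3 := h.lower t 0
  rwa [h.base] at h3

/-! ### Geodesic rays -/

theorem QuasiGeodesicRay.base (β : QuasiGeodesicRay o) : β.1 0 = o := by
  obtain ⟨q, Q, h⟩ := β.2
  exact h.base

theorem QuasiGeodesicRay.IsGeodesic.isQuasiGeodesicRay {β : QuasiGeodesicRay o}
    (h : β.IsGeodesic) : IsQuasiGeodesicRay o 1 0 β.1 := by
  refine ⟨le_rfl, le_rfl, Isometry.continuous h, β.base, fun s t => ?_, fun s t => ?_⟩ <;>
    rw [Isometry.dist_eq h] <;> simp

theorem QuasiGeodesicRay.IsGeodesic.dist_base {β : QuasiGeodesicRay o} (h : β.IsGeodesic)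
    (t : ℝ≥0) : dist o (β.1 t) = t := by
  rw [← nnreal_dist_zero, ← Isometry.dist_eq h, β.base]

theorem QuasiGeodesicRay.IsGeodesic.firstTime {β : QuasiGeodesicRay o} (h : β.IsGeodesic)
    (t : ℝ≥0) : firstTime o β.1 t = t := by
  have h1 := h.isQuasiGeodesicRay.dist_firstTime t.2
  rw [h.dist_base] at h1
  exact NNReal.eq h1

theorem QuasiGeodesicRay.IsGeodesic.abs_sub_le {β : QuasiGeodesicRay o} (h : β.IsGeodesic)
    (x : X) (t : ℝ≥0) : |dist o x - t| ≤ dist x (β.1 t) := by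
  have h1 := abs_dist_sub_le x (β.1 t) o
  rwa [dist_comm x o, dist_comm _ o, h.dist_base] at h1

/-- The parameter of a nearest point differs from ‖x‖ by at most the distance to the ray, so sliding
along the ray to parameter ‖x‖ at most doubles the distance. -/
theorem QuasiGeodesicRay.IsGeodesic.dist_le_two_mul_infDist [ProperSpace X]
    {β : QuasiGeodesicRay o} (h : β.IsGeodesic) (x : X) {t : ℝ≥0} (ht : dist o x = t) :
    dist x (β.1 t) ≤ 2 * Metric.infDist x (range β.1) := by
  obtain ⟨y, ⟨u, rfl⟩, hy⟩ := h.isQuasiGeodesicRay.isClosed_range.exists_infDist_eq_dist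
    (range_nonempty _) x
  have h1 := h.abs_sub_le x u
  have h2 := dist_triangle x (β.1 u) (β.1 t)
  rw [Isometry.dist_eq h, NNReal.dist_eq, abs_sub_comm, ← ht] at h2
  linarith

end Rays

/-! ### Uniqueness of geodesic rays in CAT(0) spaces -/

section CAT0

variable {X : Type*} [MetricSpace X] {o : X}

theorem QuasiGeodesicRay.IsGeodesic.isGeodesicSegment {β : QuasiGeodesicRay o}
    (h : β.IsGeodesic) (T : ℝ≥0) :
    IsGeodesicSegment (fun t => β.1 t.toNNReal) T o (β.1 T) := by
  refine ⟨T.2, by simp [β.base], by simp, fun s hs t ht => ?_⟩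
  rw [Isometry.dist_eq h, NNReal.dist_eq, Real.coe_toNNReal _ hs.1, Real.coe_toNNReal _ ht.1]

/-- Geodesic rays from the same point in a CAT(0) space diverge at least linearly. -/
theorem IsCAT0.dist_geodesic_le (hX : IsCAT0 X) {β γ : QuasiGeodesicRay o} (hβ : β.IsGeodesic)
    (hγ : γ.IsGeodesic) {t T : ℝ≥0} (htT : t ≤ T) (hT : 0 < T) :
    dist (β.1 t) (γ.1 t) ≤ t / T * dist (β.1 T) (γ.1 T) := by
  set D := dist (β.1 T) (γ.1 T) with hD
  have hD0 : 0 ≤ D := dist_nonneg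
  have hT' : (0 : ℝ) < T := by exact_mod_cast hT
  have htT' : (t : ℝ) ≤ T := by exact_mod_cast htT
  have hD2 : D ≤ 2 * T := by
    have := dist_triangle_left (β.1 T) (γ.1 T) o
    rw [hβ.dist_base, hγ.dist_base] at this
    linarith
  -- The comparison triangle is isosceles, with apex at the origin and base vertices (a, ±D/2).
  -- Scaling by c = t/T produces the two comparison points.
  set a : ℝ := √((T : ℝ) ^ 2 - (D / 2) ^ 2) with ha
  have hsq : 0 ≤ (T : ℝ) ^ 2 - (D / 2) ^ 2 := by nlinarith
  have ha2 : a ^ 2 = (T : ℝ) ^ 2 - (D / 2) ^ 2 := Real.sq_sqrt hsq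
  let c : ℝ := t / T
  have hc0 : 0 ≤ c := by positivity
  have hc1 : c ≤ 1 := (div_le_one hT').2 htT'
  have hcT : c * T = t := div_mul_cancel₀ _ hT'.ne'
  have dist_fin_two : ∀ x y x' y' : ℝ, dist (!₂[x, y] : EuclideanSpace ℝ (Fin 2)) !₂[x', y'] =
      √((x - x') ^ 2 + (y - y') ^ 2) := by
    intro x y x' y'
    simp [EuclideanSpace.dist_eq, Real.dist_eq, sq_abs]
  have hmem : ∀ b : ℝ, (!₂[c * a, c * b] : EuclideanSpace ℝ (Fin 2)) ∈
      segment ℝ (!₂[0, 0] : EuclideanSpace ℝ (Fin 2)) !₂[a, b] := by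
    intro b
    refine ⟨1 - c, c, by linarith, hc0, by ring, ?_⟩
    ext i
    fin_cases i <;> simp
  have hside : ∀ b : ℝ, b ^ 2 = (D / 2) ^ 2 → ∀ k : ℝ, 0 ≤ k →
      dist (!₂[0, 0] : EuclideanSpace ℝ (Fin 2)) !₂[k * a, k * b] = k * T := by
    intro b hb k hk
    rw [dist_fin_two, show (0 - k * a) ^ 2 + (0 - k * b) ^ 2 = (k * T) ^ 2 by
      rw [zero_sub, zero_sub, neg_sq, neg_sq, mul_pow, mul_pow, hb, ha2]; ring]
    exact Real.sqrt_sq (by positivity)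
  have hside1 : ∀ b : ℝ, b ^ 2 = (D / 2) ^ 2 →
      dist (!₂[0, 0] : EuclideanSpace ℝ (Fin 2)) !₂[a, b] = T := by
    intro b hb
    simpa using hside b hb 1 zero_le_one
  have hbase : ∀ k : ℝ, 0 ≤ k →
      dist (!₂[k * a, k * (D / 2)] : EuclideanSpace ℝ (Fin 2)) !₂[k * a, k * -(D / 2)] =
        k * D := by
    intro k hk
    rw [dist_fin_two, show (k * a - k * a) ^ 2 + (k * (D / 2) - k * -(D / 2)) ^ 2 = (k * D) ^ 2
      by ring]
    exact Real.sqrt_sq (by positivity)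
  have h := hX.comparison o (β.1 T) (γ.1 T) _ _ T T (hβ.isGeodesicSegment T)
    (hγ.isGeodesicSegment T) !₂[0, 0] !₂[a, D / 2] !₂[a, -(D / 2)]
    (by rw [hside1 _ rfl, hβ.dist_base]) (by rw [hside1 _ (neg_sq _), hγ.dist_base])
    (by simpa using hbase 1 zero_le_one) t ⟨t.2, htT'⟩ t ⟨t.2, htT'⟩ _ (hmem _) _ (hmem _)
    (by rw [hside _ rfl _ hc0, hcT]) (by rw [hside _ (neg_sq _) _ hc0, hcT])
  rw [hbase c hc0] at h
  simpa using h

/-- By convexity the distance at time t is at most t/T times the distance at time T, which is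
O(κ(T)); let T tend to infinity. -/
theorem IsCAT0.eq_of_forall_infDist_le [ProperSpace X] (hX : IsCAT0 X) {κ : SublinearFn}
    {β γ : QuasiGeodesicRay o} (hβ : β.IsGeodesic) (hγ : γ.IsGeodesic) {n : ℝ}
    (h : ∀ t, Metric.infDist (β.1 t) (range γ.1) ≤ n * κ t) : β = γ := by
  refine Subtype.ext (funext fun t => dist_le_zero.1 (le_of_forall_pos_le_add fun ε hε => ?_))
  rw [zero_add]
  obtain ⟨T, hT, hTt, hT0⟩ := ((κ.eventually_mul_le (2 * n * t) hε).and
    ((eventually_ge_atTop (t : ℝ)).and (eventually_gt_atTop 0))).exists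
  lift T to ℝ≥0 using hT0.le
  have h1 := hX.dist_geodesic_le hβ hγ (by exact_mod_cast hTt) (by exact_mod_cast hT0)
  have h2 := hγ.dist_le_two_mul_infDist (β.1 T) (hβ.dist_base T)
  refine h1.trans ?_
  rw [div_mul_eq_mul_div, div_le_iff₀ hT0]
  have h3 := h T
  have ht : (0 : ℝ) ≤ t := t.2
  nlinarith

end CAT0

/-! ### Quasi-geodesics and contracting sets -/

section Morse

variable {X : Type*} [MetricSpace X] {o : X} {κ : SublinearFn} {Z : Set X} {q Q c : ℝ}

/-- `η` is a continuous `(q, Q)`-quasi-geodesic on `[0, T]`. -/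
structure IsQuasiGeodesicOn (q Q : ℝ) (η : ℝ → X) (T : ℝ) : Prop where
  one_le : 1 ≤ q
  nonneg : 0 ≤ Q
  continuousOn : ContinuousOn η (Icc 0 T)
  lower : ∀ s t : ℝ, 0 ≤ s → s ≤ t → t ≤ T → t - s ≤ q * (dist (η s) (η t) + Q)
  upper : ∀ s t : ℝ, 0 ≤ s → s ≤ t → t ≤ T → dist (η s) (η t) ≤ q * (t - s) + Q

theorem IsQuasiGeodesicRay.isQuasiGeodesicOn {α : ℝ≥0 → X} (h : IsQuasiGeodesicRay o q Q α)
    (T : ℝ) : IsQuasiGeodesicOn q Q (fun t => α t.toNNReal) T := by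
  have hd : ∀ s t : ℝ, 0 ≤ s → s ≤ t → dist s.toNNReal t.toNNReal = t - s := by
    intro s t hs hst
    rw [NNReal.dist_eq, Real.coe_toNNReal _ hs, Real.coe_toNNReal _ (hs.trans hst), abs_sub_comm,
      abs_of_nonneg (sub_nonneg.2 hst)]
  refine ⟨h.one_le, h.nonneg, (h.continuous.comp continuous_real_toNNReal).continuousOn,
    fun s t hs hst _ => ?_, fun s t hs hst _ => ?_⟩
  · rw [← hd s t hs hst]
    exact h.dist_mul_sub_le _ _
  · rw [← hd s t hs hst]
    exact h.upper _ _

theorem IsGeodesicSegment.isQuasiGeodesicOn {γ : ℝ → X} {l : ℝ} {p p' : X}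
    (h : IsGeodesicSegment γ l p p') : IsQuasiGeodesicOn 1 0 γ l := by
  have hd : ∀ s t : ℝ, 0 ≤ s → s ≤ t → t ≤ l → dist (γ s) (γ t) = t - s := by
    intro s t hs hst ht
    rw [h.2.2.2 s ⟨hs, hst.trans ht⟩ t ⟨hs.trans hst, ht⟩, abs_sub_comm,
      abs_of_nonneg (sub_nonneg.2 hst)]
  refine ⟨le_rfl, le_rfl, ?_, fun s t hs hst ht => ?_, fun s t hs hst ht => ?_⟩
  · refine LipschitzOnWith.continuousOn (K := 1) (LipschitzOnWith.of_dist_le_mul ?_)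
    intro s hs t ht
    rw [h.2.2.2 s hs t ht, NNReal.coe_one, one_mul, Real.dist_eq]
  · rw [hd s t hs hst ht]
    linarith
  · rw [hd s t hs hst ht]
    linarith

/-! ### Slow projections, excursions and gauges of contracting sets -/

/-- Nearest-point projections to `Z` of balls disjoint from `Z` have diameter at most
`c * κ(‖x‖)`, where `x` is the centre of the ball. -/
def HasContractionConst (κ : SublinearFn) (o : X) (Z : Set X) (c : ℝ) : Prop :=
  ∀ x y : X, dist x y ≤ Metric.infDist x Z → ∀ p ∈ nearestPoints Z x, ∀ p' ∈ nearestPoints Z y,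
    dist p p' ≤ c * κ (dist o x)

theorem isBounded_nearestPoints (Z : Set X) (x : X) :
    Bornology.IsBounded (nearestPoints Z x) := by
  refine (Metric.isBounded_closedBall (x := x) (r := Metric.infDist x Z)).subset ?_
  intro z hz
  rw [Metric.mem_closedBall, dist_comm]
  exact hz.2.le

theorem nearestPoints_nonempty [ProperSpace X] (hZ : IsClosed Z) (hne : Z.Nonempty) (x : X) :
    (nearestPoints Z x).Nonempty := by
  obtain ⟨y, hy, h⟩ := hZ.exists_infDist_eq_dist hne x
  exact ⟨y, hy, h.symm⟩

theorem IsContracting.exists_const (h : IsContracting κ o Z) :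
    ∃ c : ℝ, 1 ≤ c ∧ HasContractionConst κ o Z c := by
  obtain ⟨c, hc⟩ := h
  refine ⟨max c 1, le_max_right _ _, fun x y hxy p hp p' hp' => ?_⟩
  have h1 := Metric.dist_le_diam_of_mem
    ((isBounded_nearestPoints Z x).union (isBounded_nearestPoints Z y)) (Or.inl hp) (Or.inr hp')
  refine h1.trans ((hc x y hxy).trans ?_)
  have := κ.pos (dist_nonneg (x := o) (y := x))
  gcongr
  exact le_max_left _ _

/-- The projection to a contracting set of a quasi-geodesic far away from it moves slowly. -/
theorem IsQuasiGeodesicOn.dist_nearestPoints_le [ProperSpace X] (hZ : IsClosed Z)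
    (hne : Z.Nonempty) (hc : 1 ≤ c) (hZc : HasContractionConst κ o Z c) {η : ℝ → X} {T : ℝ}
    (hη : IsQuasiGeodesicOn q Q η T) {e K N : ℝ} (heT : e ≤ T) (hK : 4 * q ^ 2 * c + 2 * Q ≤ K)
    (n : ℕ) : ∀ s : ℝ, 0 ≤ s → s ≤ e → e - s ≤ n * (K / (2 * q)) →
      (∀ t ∈ Icc s e, K * κ (dist o (η t)) ≤ Metric.infDist (η t) Z) →
      (∀ t ∈ Icc s e, dist o (η t) ≤ N) →
      ∀ p ∈ nearestPoints Z (η s), ∀ p' ∈ nearestPoints Z (η e),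
        dist p p' ≤ (e - s) / (2 * q) + c * κ N := by
  have hq := hη.one_le
  have hQ := hη.nonneg
  have hq2 : 1 ≤ q ^ 2 := one_le_pow₀ hq
  have hK0 : 0 < K := by nlinarith
  have near : ∀ s : ℝ, s ≤ e → (∀ t ∈ Icc s e, dist o (η t) ≤ N) →
      dist (η s) (η e) ≤ Metric.infDist (η s) Z →
      ∀ p ∈ nearestPoints Z (η s), ∀ p' ∈ nearestPoints Z (η e),
        dist p p' ≤ (e - s) / (2 * q) + c * κ N := by
    intro s hse hN hd p hp p' hp'
    have h1 := hZc _ _ hd p hp p' hp'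
    have h2 := hN s ⟨le_rfl, hse⟩
    have h3 : κ (dist o (η s)) ≤ κ N :=
      κ.mono (mem_Ici.2 dist_nonneg) (mem_Ici.2 (dist_nonneg.trans h2)) h2
    have h4 : 0 ≤ (e - s) / (2 * q) := div_nonneg (by linarith) (by linarith)
    have h5 : c * κ (dist o (η s)) ≤ c * κ N := by gcongr
    linarith
  induction n with
  | zero =>
    intro s hs hse hn _ hN
    rw [Nat.cast_zero, zero_mul] at hn
    obtain rfl : s = e := by linarith
    exact near s le_rfl hN (by rw [dist_self]; exact Metric.infDist_nonneg)
  | succ n ih =>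
    intro s hs hse hn hfar hN p hp p' hp'
    by_cases hd : dist (η s) (η e) ≤ Metric.infDist (η s) Z
    · exact near s hse hN hd p hp p' hp'
    push Not at hd
    have hcont : ContinuousOn (fun t => dist (η s) (η t)) (Icc s e) :=
      (continuous_const.dist continuous_id).comp_continuousOn
        (hη.continuousOn.mono (Icc_subset_Icc hs heT))
    -- Step to the boundary of the largest ball about `η s` to which contraction applies. The step
    -- takes time at least K/(2q) (`h5`), which drives the induction, and moves the projection by at
    -- most (t - s)/(2q) (`h6`). The lower bound on K is made for these two estimates. Only the
    -- final, incomplete step costs c κ(N).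
    obtain ⟨t, ht, hdt⟩ := intermediate_value_Icc hse hcont
      (show Metric.infDist (η s) Z ∈ Icc _ _ from
        ⟨by rw [dist_self]; exact Metric.infDist_nonneg, hd.le⟩)
    replace hdt : dist (η s) (η t) = Metric.infDist (η s) Z := hdt
    obtain ⟨p₁, hp₁⟩ := nearestPoints_nonempty hZ hne (η t)
    have h1 := hZc _ _ hdt.le p hp p₁ hp₁
    have h2 := hη.upper s t hs ht.1 (ht.2.trans heT)
    have h3 := hfar s ⟨le_rfl, hse⟩
    rw [hdt] at h2
    have hκ := κ.one_le (dist o (η s)) dist_nonneg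
    have hKκ : K ≤ K * κ (dist o (η s)) := le_mul_of_one_le_right hK0.le hκ
    have hcq : 0 ≤ 4 * q ^ 2 * c := by positivity
    have h4 : K * κ (dist o (η s)) / 2 ≤ q * (t - s) := by linarith
    have h5 : K / (2 * q) ≤ t - s := by
      rw [div_le_iff₀ (by positivity)]
      linarith
    have h6 : c * κ (dist o (η s)) ≤ (t - s) / (2 * q) := by
      rw [le_div_iff₀ (by positivity)]
      refine le_of_mul_le_mul_left (a := q) ?_ (by linarith)
      have : 4 * q ^ 2 * c * κ (dist o (η s)) ≤ K * κ (dist o (η s)) := by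
        gcongr
        linarith
      linarith
    have h7 := ih t (hs.trans ht.1) ht.2 (by push_cast at hn; linarith)
      (fun u hu => hfar u ⟨ht.1.trans hu.1, hu.2⟩) (fun u hu => hN u ⟨ht.1.trans hu.1, hu.2⟩)
      p₁ hp₁ p' hp'
    have h8 : (e - s) / (2 * q) = (t - s) / (2 * q) + (e - t) / (2 * q) := by ring
    linarith [dist_triangle p p₁ p']

/-- An excursion of a quasi-geodesic away from a contracting set is short. -/
theorem IsQuasiGeodesicOn.excursion_le [ProperSpace X] (hZ : IsClosed Z)
    (hne : Z.Nonempty) (hc : 1 ≤ c) (hZc : HasContractionConst κ o Z c) {η : ℝ → X} {T : ℝ}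
    (hη : IsQuasiGeodesicOn q Q η T) {s e K N : ℝ} (hs : 0 ≤ s) (hse : s ≤ e) (heT : e ≤ T)
    (hK : 4 * q ^ 2 * c + 2 * Q ≤ K)
    (hfar : ∀ t ∈ Icc s e, K * κ (dist o (η t)) ≤ Metric.infDist (η t) Z)
    (hN : ∀ t ∈ Icc s e, dist o (η t) ≤ N) :
    e - s ≤ 2 * q * (Q + Metric.infDist (η s) Z + Metric.infDist (η e) Z + c * κ N) := by
  have hq := hη.one_le
  have hQ := hη.nonneg
  have hq2 : 1 ≤ q ^ 2 := one_le_pow₀ hq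
  have hK0 : 0 < K := by nlinarith
  obtain ⟨p, hp⟩ := nearestPoints_nonempty hZ hne (η s)
  obtain ⟨p', hp'⟩ := nearestPoints_nonempty hZ hne (η e)
  obtain ⟨n, hn⟩ := exists_nat_ge ((e - s) / (K / (2 * q)))
  rw [div_le_iff₀ (by positivity)] at hn
  have h1 := hη.dist_nearestPoints_le hZ hne hc hZc heT hK n s hs hse hn hfar hN p hp p' hp'
  have h2 := hη.lower s e hs hse heT
  have h3 : dist (η s) (η e) ≤ Metric.infDist (η s) Z + dist p p' + Metric.infDist (η e) Z := by
    rw [← hp.2, ← hp'.2, dist_comm (η e) p']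
    exact dist_triangle4 _ _ _ _
  -- The projection speed 1/(2q) was chosen so that this term can be absorbed into the left-hand
  -- side.
  have h4 : q * ((e - s) / (2 * q)) = (e - s) / 2 := by field_simp
  have h5 : q * (dist (η s) (η e) + Q) ≤ q * (Metric.infDist (η s) Z +
      ((e - s) / (2 * q) + c * κ N) + Metric.infDist (η e) Z + Q) := by
    gcongr
    linarith
  linarith

theorem exists_last_zero {h : ℝ → ℝ} {a t : ℝ} (hat : a ≤ t) (hc : ContinuousOn h (Icc a t))
    (ha : h a ≤ 0) (ht : 0 ≤ h t) : ∃ s ∈ Icc a t, h s = 0 ∧ ∀ u ∈ Icc s t, 0 ≤ h u := by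
  have hK : IsCompact {u ∈ Icc a t | h u ≤ 0} :=
    isCompact_Icc.of_isClosed_subset
      (hc.preimage_isClosed_of_isClosed isClosed_Icc isClosed_Iic) (sep_subset _ _)
  obtain ⟨s, ⟨hs, hs0⟩, hmax⟩ := hK.exists_isGreatest ⟨a, ⟨le_rfl, hat⟩, ha⟩
  obtain ⟨u, hu, hu0⟩ := intermediate_value_Icc hs.2 (hc.mono (Icc_subset_Icc_left hs.1))
    (show (0 : ℝ) ∈ Icc _ _ from ⟨hs0, ht⟩)
  have hus : u = s := le_antisymm (hmax ⟨⟨hs.1.trans hu.1, hu.2⟩, hu0.le⟩) hu.1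
  have hs0' : h s = 0 := hus ▸ hu0
  refine ⟨s, hs, hs0', fun v hv => ?_⟩
  by_contra! hneg
  have : v = s := le_antisymm (hmax ⟨⟨hs.1.trans hv.1, hv.2⟩, hneg.le⟩) hv.1
  rw [this, hs0'] at hneg
  exact lt_irrefl _ hneg

theorem exists_first_zero {h : ℝ → ℝ} {t b : ℝ} (htb : t ≤ b) (hc : ContinuousOn h (Icc t b))
    (hb : h b ≤ 0) (ht : 0 ≤ h t) : ∃ e ∈ Icc t b, h e = 0 ∧ ∀ u ∈ Icc t e, 0 ≤ h u := by
  obtain ⟨s, hs, hs0, h1⟩ := exists_last_zero (h := fun u => h (-u)) (neg_le_neg htb)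
    (hc.comp continuous_neg.continuousOn fun u hu => ⟨le_neg.2 hu.2, neg_le.2 hu.1⟩)
    (by simpa using hb) (by simpa using ht)
  refine ⟨-s, ⟨le_neg.2 hs.2, neg_le.2 hs.1⟩, hs0, fun u hu => ?_⟩
  simpa using h1 (-u) ⟨le_neg.2 hu.2, neg_le_neg hu.1⟩

theorem SublinearFn.add_one_le (κ : SublinearFn) {t : ℝ} (ht : 0 ≤ t) :
    κ (t + 1) ≤ (1 + κ 1) * κ t := by
  have h1 := κ.add_le ht zero_le_one
  have h2 := κ.one_le t ht
  have h3 := κ.one_le 1 zero_le_one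
  nlinarith

/-- The excess of the distance to `Z` over a continuous function comparable to `κ`. -/
noncomputable def excess (κ : SublinearFn) (o : X) (Z : Set X) (K : ℝ) (x : X) : ℝ :=
  Metric.infDist x Z - K * κ (dist o x + 1)

theorem continuous_excess (K : ℝ) : Continuous (excess κ o Z K) := by
  refine (Metric.continuous_infDist_pt Z).sub (continuous_const.mul ?_)
  exact κ.continuousOn_add_one.comp_continuous (continuous_const.dist continuous_id)
    fun x => dist_nonneg

theorem excess_base_nonpos (ho : o ∈ Z) {K : ℝ} (hK : 0 ≤ K) : excess κ o Z K o ≤ 0 := by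
  have := κ.pos (t := dist o o + 1) (by positivity)
  rw [excess, Metric.infDist_zero_of_mem ho, zero_sub, neg_nonpos]
  positivity

theorem le_infDist_of_excess_nonneg {K : ℝ} (hK : 0 ≤ K) {x : X} (h : 0 ≤ excess κ o Z K x) :
    K * κ (dist o x) ≤ Metric.infDist x Z := by
  have hd : 0 ≤ dist o x := dist_nonneg
  have h1 := κ.mono (mem_Ici.2 hd) (mem_Ici.2 (by positivity)) (le_add_of_nonneg_right zero_le_one)
  have h2 : K * κ (dist o x) ≤ K * κ (dist o x + 1) := by gcongr
  rw [excess] at h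
  linarith

/-- A quasi-geodesic which starts in a contracting set and returns to it stays close to it. -/
theorem exists_infDist_le_of_return [ProperSpace X] (hZ : IsClosed Z) (ho : o ∈ Z) (hc : 1 ≤ c)
    (hZc : HasContractionConst κ o Z c) (hq : 1 ≤ q) (hQ : 0 ≤ Q) :
    ∃ m : ℝ, ∀ (η : ℝ → X) (T : ℝ), IsQuasiGeodesicOn q Q η T → η 0 = o →
      ∀ t b : ℝ, 0 ≤ t → t ≤ b → b ≤ T → excess κ o Z (4 * q ^ 2 * c + 2 * Q) (η b) ≤ 0 →
        Metric.infDist (η t) Z ≤ m * κ (dist o (η t)) := by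
  set K := 4 * q ^ 2 * c + 2 * Q with hK
  have hK0 : 0 ≤ K := by positivity
  -- B is the total coefficient of κ in the excursion bound when both endpoints have excess zero.
  -- The slope 1/(2qB) below makes B κ(w) cost only M/2 for w = qM + Q + 1, and A is what remains in
  -- M ≤ A κ(‖η t‖) after absorption.
  set B := 2 * q * (2 * K + c) with hB
  have hB0 : 0 < B := by positivity
  have hKB : K ≤ B := by nlinarith
  obtain ⟨C, hC0, hC⟩ := κ.exists_le_mul_add (ε := 1 / (2 * q * B)) (by positivity)
  set A := 4 * q * Q + 2 * B + Q + 1 + 2 * B * C with hA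
  have hκ1 := κ.one_le 1 zero_le_one
  have hA0 : 0 ≤ A := by positivity
  refine ⟨max (K * (1 + κ 1)) (q * A + Q + K + A / 2 + (Q + 1) / 2 + B * C),
    fun η T hη hη0 t b ht htb hbT hb => ?_⟩
  have hdt : 0 ≤ dist o (η t) := dist_nonneg
  have hκt := κ.one_le _ hdt
  rcases le_total (excess κ o Z K (η t)) 0 with hneg | hpos
  · rw [excess] at hneg
    have h1 := κ.add_one_le hdt
    calc Metric.infDist (η t) Z ≤ K * κ (dist o (η t) + 1) := by linarith
      _ ≤ K * ((1 + κ 1) * κ (dist o (η t))) := by gcongr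
      _ = K * (1 + κ 1) * κ (dist o (η t)) := by ring
      _ ≤ _ := by
        gcongr
        exact le_max_left _ _
  have hcont : ContinuousOn (fun u => excess κ o Z K (η u)) (Icc 0 T) :=
    (continuous_excess K).comp_continuousOn hη.continuousOn
  have htT : t ≤ T := htb.trans hbT
  obtain ⟨s, hs, hs0, hsu⟩ := exists_last_zero ht (hcont.mono (Icc_subset_Icc_right htT))
    (by simpa only [hη0] using excess_base_nonpos ho hK0) hpos
  obtain ⟨e, he, he0, heu⟩ := exists_first_zero htb (hcont.mono (Icc_subset_Icc ht hbT)) hb hpos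
  set M := e - s with hM
  have hst := hs.2
  have hte := he.1
  have hM0 : 0 ≤ M := by linarith
  have heT : e ≤ T := he.2.trans hbT
  set w := q * M + Q + 1 with hw
  have hw0 : 0 ≤ w := by positivity
  have hN : ∀ u ∈ Icc s e, dist o (η u) + 1 ≤ dist o (η t) + w := by
    intro u hu
    have h1 : dist (η t) (η u) ≤ q * M + Q := by
      rcases le_total t u with h | h
      · have h2 := hη.upper t u ht h (hu.2.trans heT)
        have : q * (u - t) ≤ q * M := by
          gcongr
          linarith [hu.2]
        linarith
      · have h2 := hη.upper u t (hs.1.trans hu.1) h htT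
        rw [dist_comm] at h2
        have : q * (t - u) ≤ q * M := by
          gcongr
          linarith [hu.1]
        linarith
    linarith [dist_triangle o (η t) (η u)]
  have hfar : ∀ u ∈ Icc s e, K * κ (dist o (η u)) ≤ Metric.infDist (η u) Z := by
    intro u hu
    refine le_infDist_of_excess_nonneg hK0 ?_
    rcases le_total u t with h | h
    · exact hsu u ⟨hu.1, h⟩
    · exact heu u ⟨h, hu.2⟩
  have hsplit : κ (dist o (η t) + w) ≤ κ (dist o (η t)) + κ w := κ.add_le hdt hw0
  have hend : ∀ u ∈ Icc s e, excess κ o Z K (η u) = 0 →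
      Metric.infDist (η u) Z ≤ K * (κ (dist o (η t)) + κ w) := by
    intro u hu hu0
    rw [excess, sub_eq_zero] at hu0
    rw [hu0]
    have hdu : 0 ≤ dist o (η u) := dist_nonneg
    have := (κ.mono (mem_Ici.2 (by positivity)) (mem_Ici.2 (by positivity)) (hN u hu)).trans hsplit
    gcongr
  have hs1 := hend s ⟨le_rfl, hst.trans hte⟩ hs0
  have he1 := hend e ⟨hst.trans hte, le_rfl⟩ he0
  have hlen := hη.excursion_le hZ ⟨o, ho⟩ hc hZc hs.1 (hst.trans hte) heT le_rfl hfar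
    (N := dist o (η t) + w) fun u hu => by linarith [hN u hu]
  have hBw : B * κ w ≤ M / 2 + (Q + 1) / 2 + B * C := by
    have h1 : B * κ w ≤ B * (1 / (2 * q * B) * w + C) := by
      gcongr
      exact hC w hw0
    have h2 : B * (1 / (2 * q * B) * w + C) = M / 2 + (Q + 1) / (2 * q) + B * C := by
      rw [hw]
      field_simp
      ring
    have h3 : (Q + 1) / (2 * q) ≤ (Q + 1) / 2 := by
      gcongr
      linarith
    linarith
  have hκw := κ.pos hw0
  have hMle : M ≤ A * κ (dist o (η t)) := by
    have h1 : M ≤ 2 * q * Q + B * (κ (dist o (η t)) + κ w) := by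
      have h2 : 2 * q * (Q + Metric.infDist (η s) Z + Metric.infDist (η e) Z +
          c * κ (dist o (η t) + w)) ≤ 2 * q * (Q + K * (κ (dist o (η t)) + κ w) +
          K * (κ (dist o (η t)) + κ w) + c * (κ (dist o (η t)) + κ w)) := by
        gcongr
      rw [hB]
      linarith
    have h3 : 0 ≤ 4 * q * Q + Q + 1 + 2 * B * C := by positivity
    have h4 := le_mul_of_one_le_right h3 hκt
    rw [hA]
    linarith
  have hfin : Metric.infDist (η t) Z ≤
      (q * A + Q + K + A / 2 + (Q + 1) / 2 + B * C) * κ (dist o (η t)) := by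
    have h1 := Metric.infDist_le_infDist_add_dist (s := Z) (x := η t) (y := η s)
    have h2 := hη.upper s t hs.1 hst htT
    rw [dist_comm] at h2
    have h3 : q * (t - s) ≤ q * (A * κ (dist o (η t))) := by
      gcongr
      linarith
    have h4 : K * κ w ≤ B * κ w := by gcongr
    have h5 : 0 ≤ Q + (Q + 1) / 2 + B * C := by positivity
    have h6 := le_mul_of_one_le_right h5 hκt
    linarith
  refine hfin.trans ?_
  gcongr
  exact le_max_right _ _

/-- A quasi-geodesic which leaves a contracting set close to the base-point and never returns
cannot be close to it far away from the base-point. -/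
theorem exists_no_escape [ProperSpace X] (hZ : IsClosed Z) (hne : Z.Nonempty) (hc : 1 ≤ c)
    (hZc : HasContractionConst κ o Z c) {P r : ℝ} (hP : 1 ≤ P) (hr : 0 ≤ r) :
    ∃ ε : ℝ, 0 < ε ∧ ∃ R₁ : ℝ, ∀ q Q : ℝ, q ≤ P → Q ≤ P → ∀ (η : ℝ → X) (T : ℝ),
      IsQuasiGeodesicOn q Q η T → ∀ s : ℝ, 0 ≤ s → s ≤ T → dist o (η s) ≤ r →
      excess κ o Z (4 * q ^ 2 * c + 2 * Q) (η s) ≤ 0 →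
      (∀ u ∈ Icc s T, 0 ≤ excess κ o Z (4 * q ^ 2 * c + 2 * Q) (η u)) →
      R₁ ≤ dist o (η T) → Metric.infDist (η T) Z ≤ ε * dist o (η T) → False := by
  set K' := 4 * P ^ 2 * c + 2 * P with hK'
  obtain ⟨C, hC0, hC⟩ := κ.exists_le_mul_add (ε := 1 / (4 * P ^ 2 * c)) (by positivity)
  have hκr := κ.pos (t := r + 1) (by positivity)
  set A := 4 * P * (P + K' * κ (r + 1)) + r + 1 + 4 * P * c * C with hA
  -- The excursion bound gives M ≤ A + 4Pd with d the final distance to Z, so the final norm is at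
  -- most r + P + PA + 4P²d. This ε turns the last term into half of the norm, and R₁ exceeds the
  -- resulting bound. Both depend only on P and r, not on q and Q, as the order of quantifiers in a
  -- gauge demands.
  refine ⟨1 / (8 * P ^ 2), by positivity, 2 * (r + P + P * A) + 1,
    fun q Q hqP hQP η T hη s hs hsT hsr hs0 hfar hR hd => ?_⟩
  have hq := hη.one_le
  have hQ := hη.nonneg
  set K := 4 * q ^ 2 * c + 2 * Q with hK
  have hK0 : 0 ≤ K := by positivity
  have hKK' : K ≤ K' := by
    rw [hK, hK']
    gcongr
  set M := T - s with hM
  have hM0 : 0 ≤ M := by linarith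
  have hN : ∀ u ∈ Icc s T, dist o (η u) ≤ r + P * M + P := by
    intro u hu
    have h1 := hη.upper s u hs hu.1 hu.2
    have h2 : q * (u - s) ≤ P * M := by
      have := hu.1
      gcongr
      linarith [hu.2]
    linarith [dist_triangle o (η s) (η u)]
  have hlen := hη.excursion_le hZ hne hc hZc hs hsT le_rfl le_rfl
    (fun u hu => le_infDist_of_excess_nonneg hK0 (hfar u hu)) hN
  set d := Metric.infDist (η T) Z with hd'
  have hd0 : 0 ≤ d := Metric.infDist_nonneg
  have hN0 : 0 ≤ r + P * M + P := by positivity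
  have hκN := κ.pos hN0
  have hs1 : Metric.infDist (η s) Z ≤ K' * κ (r + 1) := by
    have hds : 0 ≤ dist o (η s) := dist_nonneg
    have h1 : κ (dist o (η s) + 1) ≤ κ (r + 1) :=
      κ.mono (mem_Ici.2 (by positivity)) (mem_Ici.2 (by positivity)) (by linarith)
    rw [excess] at hs0
    have h2 : K * κ (dist o (η s) + 1) ≤ K' * κ (r + 1) := by
      have := κ.pos (t := dist o (η s) + 1) (by positivity)
      gcongr
    linarith
  have h1 : M ≤ 2 * P * (P + K' * κ (r + 1) + d + c * κ (r + P * M + P)) := by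
    refine hlen.trans ?_
    have : 0 ≤ Metric.infDist (η s) Z := Metric.infDist_nonneg
    gcongr
  have h2 : 2 * P * (c * κ (r + P * M + P)) ≤ r / 2 + M / 2 + 1 / 2 + 2 * P * c * C := by
    have h3 : 2 * P * (c * κ (r + P * M + P)) ≤
        2 * P * (c * (1 / (4 * P ^ 2 * c) * (r + P * M + P) + C)) := by
      gcongr
      exact hC _ hN0
    have h4 : 2 * P * (c * (1 / (4 * P ^ 2 * c) * (r + P * M + P) + C)) =
        r / (2 * P) + M / 2 + 1 / 2 + 2 * P * c * C := by
      field_simp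
      ring
    have h5 : r / (2 * P) ≤ r / 2 := by
      gcongr
      linarith
    linarith
  have h3 : M ≤ A + 4 * P * d := by
    rw [hA]
    linarith
  have h4 := hN T ⟨hsT, le_rfl⟩
  have h5 : P * M ≤ P * (A + 4 * P * d) := by gcongr
  have h6 : 4 * P ^ 2 * d ≤ dist o (η T) / 2 := by
    calc 4 * P ^ 2 * d ≤ 4 * P ^ 2 * (1 / (8 * P ^ 2) * dist o (η T)) := by gcongr
      _ = dist o (η T) / 2 := by
        field_simp
        ring
  linarith

/-- Since a gauge dominates q and Q, this bounds the quasi-geodesic constants by the radius and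
makes all later choices uniform in them. -/
theorem IsSmall.le {D r : ℝ} (h : IsSmall κ D r) (hr : 0 < r) : D ≤ r := by
  have h1 := κ.one_le r hr.le
  refine h.trans (div_le_self hr.le ?_)
  linarith

/-- Closed `κ`-contracting sets are strongly `κ`-Morse. -/
theorem IsContracting.exists_gauge [ProperSpace X] (hZ : IsClosed Z) (ho : o ∈ Z)
    (hcon : IsContracting κ o Z) : ∃ m : ℝ → ℝ → ℝ,
      (∀ q Q : ℝ, 1 ≤ q → 0 ≤ Q → max q Q ≤ m q Q) ∧
      (∀ (η : ℝ → X) (T : ℝ), IsQuasiGeodesicOn 1 0 η T → η 0 = o → η T ∈ Z →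
        ∀ t ∈ Icc 0 T, Metric.infDist (η t) Z ≤ m 1 0 * κ (dist o (η t))) ∧
      ∀ r : ℝ, 0 < r → ∃ ε : ℝ, 0 < ε ∧ ∃ R₁ : ℝ, ∀ R : ℝ, R₁ ≤ R →
        ∀ (q Q : ℝ) (η : ℝ≥0 → X), IsQuasiGeodesicRay o q Q η → IsSmall κ (m q Q) r →
          Metric.infDist (η (firstTime o η R)) Z ≤ ε * R →
          initialPiece o η r ⊆ nbhd κ o Z (m q Q) := by
  obtain ⟨c, hc, hZc⟩ := hcon.exists_const
  have hex : ∀ q Q : ℝ, ∃ m : ℝ, 1 ≤ q → 0 ≤ Q → ∀ (η : ℝ → X) (T : ℝ),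
      IsQuasiGeodesicOn q Q η T → η 0 = o → ∀ t b : ℝ, 0 ≤ t → t ≤ b → b ≤ T →
        excess κ o Z (4 * q ^ 2 * c + 2 * Q) (η b) ≤ 0 →
          Metric.infDist (η t) Z ≤ m * κ (dist o (η t)) := by
    intro q Q
    by_cases h : 1 ≤ q ∧ 0 ≤ Q
    · obtain ⟨m, hm⟩ := exists_infDist_le_of_return hZ ho hc hZc h.1 h.2
      exact ⟨m, fun _ _ => hm⟩
    · exact ⟨0, fun h1 h2 => absurd ⟨h1, h2⟩ h⟩
  choose m₀ hm₀ using hex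
  have hle : ∀ (q Q : ℝ) (x : X), m₀ q Q * κ (dist o x) ≤
      max (max q Q) (m₀ q Q) * κ (dist o x) := by
    intro q Q x
    have := κ.pos (dist_nonneg (x := o) (y := x))
    gcongr
    exact le_max_right _ _
  refine ⟨fun q Q => max (max q Q) (m₀ q Q), fun q Q _ _ => le_max_left _ _, ?_, ?_⟩
  · intro η T hη hη0 hηT t ht
    refine (hm₀ 1 0 le_rfl le_rfl η T hη hη0 t T ht.1 ht.2 le_rfl ?_).trans (hle _ _ _)
    have := κ.pos (t := dist o (η T) + 1) (by positivity)
    rw [excess, Metric.infDist_zero_of_mem hηT, zero_sub, neg_nonpos]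
    positivity
  intro r hr
  obtain ⟨ε, hε, R₁, hR₁⟩ := exists_no_escape (r := r) hZ ⟨o, ho⟩ hc hZc (le_max_left 1 r) hr.le
  refine ⟨ε, hε, max R₁ r, fun R hR q Q η hη hsmall hclose => ?_⟩
  have hmr := hsmall.le hr
  have hqr : q ≤ r := (le_max_left q Q).trans ((le_max_left _ _).trans hmr)
  have hQr : Q ≤ r := (le_max_right q Q).trans ((le_max_left _ _).trans hmr)
  have hrR : r ≤ R := (le_max_right _ _).trans hR
  have hq := hη.one_le
  have hQ := hη.nonneg
  rintro _ ⟨t, ht, rfl⟩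
  set T : ℝ≥0 := firstTime o η R with hT
  have htT : t ≤ T := ht.2.trans (firstTime_mono hη hr.le hrR)
  set η' : ℝ → X := fun u => η u.toNNReal with hη'
  have hη'c : ∀ u : ℝ≥0, η' u = η u := fun u => by simp only [hη', Real.toNNReal_coe]
  have hqg := hη.isQuasiGeodesicOn T
  have hη'0 : η' 0 = o := by simpa [hη'] using hη.base
  set K := 4 * q ^ 2 * c + 2 * Q with hK
  have hK0 : 0 ≤ K := by positivity
  change Metric.infDist (η t) Z ≤ _
  rw [← hη'c]
  refine le_trans ?_ (hle _ _ _)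
  -- Either η returns towards Z between t and T, and the return estimate applies, or it stays away
  -- from its last zero of the excess onwards, which is incompatible with being close to Z at radius
  -- R.
  by_cases hret : ∃ b : ℝ, t ≤ b ∧ b ≤ T ∧ excess κ o Z K (η' b) ≤ 0
  · obtain ⟨b, htb, hbT, hb⟩ := hret
    exact hm₀ q Q hq hQ η' T hqg hη'0 t b t.2 htb hbT hb
  push Not at hret
  exfalso
  have hcont : ContinuousOn (fun u => excess κ o Z K (η' u)) (Icc 0 T) :=
    (continuous_excess K).comp_continuousOn hqg.continuousOn
  have htT' : (t : ℝ) ≤ T := by exact_mod_cast htT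
  obtain ⟨s, hs, hs0, hsu⟩ := exists_last_zero t.2 (hcont.mono (Icc_subset_Icc_right htT'))
    (by simpa only [hη'0] using excess_base_nonpos ho hK0) (hret t le_rfl htT').le
  have hRd : dist o (η' T) = R := by rw [hη'c, hT, hη.dist_firstTime (hr.le.trans hrR)]
  refine hR₁ q Q (hqr.trans (le_max_right _ _)) (hQr.trans (le_max_right _ _)) η' T hqg s hs.1
    (hs.2.trans htT') ?_ hs0.le ?_ ?_ ?_
  · refine hη.dist_le_of_le_firstTime hr.le (le_trans ?_ ht.2)
    exact Real.toNNReal_le_iff_le_coe.2 hs.2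
  · intro u hu
    rcases le_total u t with h | h
    · exact hsu u ⟨hu.1, h⟩
    · exact (hret u h hu.2).le
  · rw [hRd]
    exact (le_max_left _ _).trans hR
  · rw [hRd, hη'c]
    exact hclose

end Morse

/-! ### The geodesic ray in a class -/

section GeodesicRepresentative

variable {X : Type*} [MetricSpace X] {o : X} {κ : SublinearFn}

theorem mem_nbhd {Z : Set X} {n : ℝ} {x : X} :
    x ∈ nbhd κ o Z n ↔ Metric.infDist x Z ≤ n * κ (dist o x) := Iff.rfl

theorem nbhd_mono {Z : Set X} {n n' : ℝ} (h : n ≤ n') : nbhd κ o Z n ⊆ nbhd κ o Z n' := by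
  intro x hx
  have := κ.pos (dist_nonneg (x := o) (y := x))
  exact (mem_nbhd.1 hx).trans (by gcongr)

/-- Limits of geodesic segments from the base-point to points of a `κ`-contracting
quasi-geodesic ray. -/
theorem IsCAT0.exists_geodesic_subset_nbhd [ProperSpace X] (hX : IsCAT0 X)
    (β : QuasiGeodesicRay o) (hcon : IsContracting κ o (range β.1)) :
    ∃ b : QuasiGeodesicRay o, b.IsGeodesic ∧ ∃ n, range b.1 ⊆ nbhd κ o (range β.1) n := by
  obtain ⟨q, Q, hβ⟩ := β.2
  have ho : o ∈ range β.1 := ⟨0, β.base⟩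
  obtain ⟨m, -, hm, -⟩ := hcon.exists_gauge hβ.isClosed_range ho
  choose γ l hγ using fun k : ℕ => hX.geodesic o (β.1 k)
  have hl : Tendsto l atTop atTop := by
    have hq : 0 < q := by linarith [hβ.one_le]
    have h1 : Tendsto (fun k : ℕ => 1 / q * (k : ℝ) - Q) atTop atTop :=
      tendsto_atTop_add_const_right _ _
        (tendsto_natCast_atTop_atTop.const_mul_atTop (by positivity))
    refine tendsto_atTop_mono (fun k => ?_) h1
    have h2 := hβ.lower 0 k
    have h3 := (hγ k).2.2.2 0 ⟨le_rfl, (hγ k).1⟩ (l k) ⟨(hγ k).1, le_rfl⟩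
    rw [(hγ k).2.1, (hγ k).2.2.1, zero_sub, abs_neg, abs_of_nonneg (hγ k).1] at h3
    rw [nnreal_dist_zero, hβ.base, h3, NNReal.coe_natCast] at h2
    exact h2
  -- Limits along a non-principal ultrafilter exist at all times simultaneously by compactness of
  -- balls, replacing a diagonal subsequence argument.
  let U : Ultrafilter ℕ := hyperfilter ℕ
  have hU : (U : Filter ℕ) ≤ atTop := by
    rw [← Nat.cofinite_eq_atTop]
    exact hyperfilter_le_cofinite
  have hev : ∀ t : ℝ≥0, ∀ᶠ k in (U : Filter ℕ), (t : ℝ) ∈ Icc 0 (l k) := fun t =>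
    hU ((hl.eventually_ge_atTop (t : ℝ)).mono fun k hk => ⟨t.2, hk⟩)
  have hdist : ∀ s t : ℝ≥0, ∀ᶠ k in (U : Filter ℕ), dist (γ k s) (γ k t) = dist s t := by
    intro s t
    filter_upwards [hev s, hev t] with k hs ht
    rw [(hγ k).2.2.2 _ hs _ ht, NNReal.dist_eq]
  have hbase : ∀ t : ℝ≥0, ∀ᶠ k in (U : Filter ℕ), dist o (γ k t) = t := by
    intro t
    filter_upwards [hdist 0 t] with k hk
    rwa [NNReal.coe_zero, (hγ k).2.1, nnreal_dist_zero] at hk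
  have hlim : ∀ t : ℝ≥0, ∃ x : X, Tendsto (fun k => γ k t) U (𝓝 x) := by
    intro t
    obtain ⟨x, -, hx⟩ := (isCompact_closedBall o (t : ℝ)).ultrafilter_le_nhds
      (U.map fun k => γ k t) (by
        rw [le_principal_iff]
        refine (hbase t).mono fun k hk => ?_
        rw [Metric.mem_closedBall, dist_comm, hk])
    exact ⟨x, hx⟩
  choose b hb using hlim
  have hiso : Isometry b := Isometry.of_dist_eq fun s t =>
    tendsto_nhds_unique_of_eventuallyEq ((hb s).dist (hb t)) tendsto_const_nhds (hdist s t)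
  have hb0 : b 0 = o := by
    refine tendsto_nhds_unique_of_eventuallyEq (hb 0) tendsto_const_nhds
      (Eventually.of_forall fun k => ?_)
    exact (hγ k).2.1
  have hqg : IsQuasiGeodesicRay o 1 0 b := by
    refine ⟨le_rfl, le_rfl, hiso.continuous, hb0, fun s t => ?_, fun s t => ?_⟩ <;>
      rw [hiso.dist_eq] <;> simp
  refine ⟨⟨b, 1, 0, hqg⟩, hiso, m 1 0, ?_⟩
  rintro _ ⟨t, rfl⟩
  change Metric.infDist (b t) _ ≤ m 1 0 * κ (dist o (b t))
  have hbt : dist o (b t) = t := by rw [← hb0, hiso.dist_eq, nnreal_dist_zero]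
  rw [hbt]
  refine le_of_tendsto (((Metric.continuous_infDist_pt _).tendsto _).comp (hb t)) ?_
  filter_upwards [hev t, hbase t] with k hk hk'
  have := hm (γ k) (l k) (hγ k).isQuasiGeodesicOn (hγ k).2.1 (by
    rw [(hγ k).2.2.1]
    exact mem_range_self _) t hk
  rwa [hk'] at this

/-- If a geodesic ray is close to a quasi-geodesic ray then the converse holds as well. -/
theorem QuasiGeodesicRay.IsGeodesic.exists_subset_nbhd [ProperSpace X] {b β : QuasiGeodesicRay o}
    (hb : b.IsGeodesic) (h : ∃ n, range b.1 ⊆ nbhd κ o (range β.1) n) :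
    ∃ n, range β.1 ⊆ nbhd κ o (range b.1) n := by
  obtain ⟨n, hn⟩ := h
  obtain ⟨q, Q, hβ⟩ := β.2
  have hq := hβ.one_le
  have hQ := hβ.nonneg
  have hclose : ∀ t : ℝ≥0, Metric.infDist (b.1 t) (range β.1) ≤ n * κ t := by
    intro t
    have := hn (mem_range_self t)
    rwa [mem_nbhd, hb.dist_base] at this
  have hn0 : 0 ≤ n := by
    have h1 := Metric.infDist_nonneg.trans (hclose 0)
    rw [NNReal.coe_zero] at h1
    exact nonneg_of_mul_nonneg_left h1 (κ.pos le_rfl)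
  have hκ1 := κ.one_le 1 zero_le_one
  -- Times at which β passes near the integer points of b. The normalisation at k = 0 ensures that
  -- the first index with `t < τ k` is a successor.
  have hτ : ∀ k : ℕ, ∃ τ : ℝ≥0, dist (b.1 k) (β.1 τ) ≤ n * κ k ∧ (k = 0 → τ = 0) := by
    intro k
    rcases eq_or_ne k 0 with rfl | hk
    · refine ⟨0, ?_, fun _ => rfl⟩
      rw [Nat.cast_zero, b.base, β.base, dist_self]
      have := κ.pos (t := ((0 : ℕ) : ℝ)) (by simp)
      positivity
    · obtain ⟨_, ⟨τ, rfl⟩, hd⟩ := hβ.isClosed_range.exists_infDist_eq_dist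
        (range_nonempty _) (b.1 k)
      refine ⟨τ, ?_, fun h => absurd h hk⟩
      rw [← hd]
      exact hclose k
  choose τ hτd hτ0 using hτ
  set A := n + q ^ 2 * (1 + n + n * (1 + κ 1) + Q) + Q with hA
  have hA0 : 0 ≤ A := by positivity
  obtain ⟨C, hC0, hC⟩ := κ.exists_le_mul_add (ε := 1 / (2 * (A + 1))) (by positivity)
  refine ⟨A * (2 + κ (2 * A * C)), ?_⟩
  rintro _ ⟨t, rfl⟩
  -- The first such index brackets t between consecutive times τ k and τ (k+1). Their images are
  -- O(κ(k)) apart, hence so are the times, and `β t` is O(κ(k)) from `b k`. Finally k is at most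
  -- linear in ‖β t‖, so κ(k) is O(κ(‖β t‖)).
  have hex : ∃ k, t < τ k := by
    by_contra! hle
    obtain ⟨k, hk1, hk2⟩ := ((tendsto_natCast_atTop_atTop (R := ℝ)).eventually
      ((κ.eventually_mul_le n (ε := 1 / 2) (by norm_num)).and
        (eventually_gt_atTop (2 * (q * t + Q))))).exists
    have h1 := hβ.upper 0 (τ k)
    rw [nnreal_dist_zero, hβ.base] at h1
    have h2 : (τ k : ℝ) ≤ t := by exact_mod_cast hle k
    have h3 : q * τ k ≤ q * t := by gcongr
    have h4 := dist_triangle_right o (b.1 k) (β.1 (τ k))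
    rw [hb.dist_base, NNReal.coe_natCast] at h4
    linarith [hτd k]
  obtain ⟨k, hk⟩ : ∃ k, Nat.find hex = k + 1 := by
    refine Nat.exists_eq_succ_of_ne_zero fun h0 => ?_
    have := Nat.find_spec hex
    rw [h0, hτ0 0 rfl] at this
    exact not_lt_zero this
  have hk1 : t < τ (k + 1) := hk ▸ Nat.find_spec hex
  have hk2 : τ k ≤ t := not_lt.1 (Nat.find_min hex (by omega))
  have hk0 : (0 : ℝ) ≤ k := k.cast_nonneg
  have hκk := κ.one_le k hk0
  have hκk1 := κ.add_one_le hk0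
  have hgap : (t : ℝ) - τ k ≤ q * (1 + n * κ k + n * ((1 + κ 1) * κ k) + Q) := by
    have h1 := hβ.dist_mul_sub_le (τ k) (τ (k + 1))
    have h2 : (t : ℝ) - τ k ≤ dist (τ k) (τ (k + 1)) := by
      rw [NNReal.dist_eq, abs_sub_comm]
      have h3 : (t : ℝ) < τ (k + 1) := by exact_mod_cast hk1
      linarith [le_abs_self ((τ (k + 1) : ℝ) - τ k)]
    have h3 : dist (β.1 (τ k)) (β.1 (τ (k + 1))) ≤
        n * κ k + 1 + n * ((1 + κ 1) * κ k) := by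
      have h4 := dist_triangle4 (β.1 (τ k)) (b.1 k) (b.1 (k + 1 : ℕ)) (β.1 (τ (k + 1)))
      have h5 : dist (b.1 k) (b.1 (k + 1 : ℕ)) = 1 := by
        rw [Isometry.dist_eq hb, NNReal.dist_eq]
        simp
      rw [dist_comm _ (b.1 k), h5] at h4
      have h6 : dist (b.1 (k + 1 : ℕ)) (β.1 (τ (k + 1))) ≤ n * κ (k + 1 : ℕ) := hτd (k + 1)
      rw [show ((k + 1 : ℕ) : ℝ) = k + 1 from Nat.cast_succ k] at h6
      have h7 : n * κ (k + 1) ≤ n * ((1 + κ 1) * κ k) := by gcongr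
      linarith [hτd k]
    have h8 : q * (dist (β.1 (τ k)) (β.1 (τ (k + 1))) + Q) ≤
        q * (n * κ k + 1 + n * ((1 + κ 1) * κ k) + Q) := by gcongr
    linarith
  have hd : dist (β.1 t) (b.1 k) ≤ A * κ k := by
    have h1 := hβ.upper (τ k) t
    have hk2' : (τ k : ℝ) ≤ t := by exact_mod_cast hk2
    rw [NNReal.dist_eq, abs_sub_comm, abs_of_nonneg (sub_nonneg.2 hk2'), dist_comm] at h1
    have h2 := dist_triangle_right (β.1 t) (b.1 k) (β.1 (τ k))
    have h3 : q * (t - τ k) ≤ q * (q * (1 + n * κ k + n * ((1 + κ 1) * κ k) + Q)) := by gcongr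
    have h4 : 0 ≤ q ^ 2 * (1 + Q) + Q := by positivity
    have h5 := le_mul_of_one_le_right h4 hκk
    rw [hA]
    linarith [hτd k]
  have hx : 0 ≤ dist o (β.1 t) := dist_nonneg
  have hkx : (k : ℝ) ≤ 2 * dist o (β.1 t) + 2 * A * C := by
    have h1 := hb.abs_sub_le (β.1 t) k
    rw [NNReal.coe_natCast, abs_le] at h1
    have h2 : A * κ k ≤ k / 2 + A * C := by
      have h3 : A * κ k ≤ A * (1 / (2 * (A + 1)) * k + C) := by
        gcongr
        exact hC k hk0
      have h4 : A * (1 / (2 * (A + 1)) * k) ≤ k / 2 := by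
        rw [one_div_mul_eq_div, mul_div_assoc', div_le_div_iff₀ (by positivity) (by norm_num)]
        nlinarith
      linarith
    linarith [h1.1]
  have hκkx : κ k ≤ (2 + κ (2 * A * C)) * κ (dist o (β.1 t)) := by
    have hAC : 0 ≤ 2 * A * C := by positivity
    have h1 := κ.mono (mem_Ici.2 hk0) (mem_Ici.2 (by positivity)) hkx
    have h2 := κ.add_le (a := 2 * dist o (β.1 t)) (by positivity) hAC
    have h3 := κ.mul_le one_le_two hx
    have h4 := le_mul_of_one_le_right (κ.pos hAC).le (κ.one_le _ hx)
    linarith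
  change Metric.infDist _ _ ≤ _
  calc Metric.infDist (β.1 t) (range b.1) ≤ dist (β.1 t) (b.1 k) :=
        Metric.infDist_le_dist_of_mem (mem_range_self _)
    _ ≤ A * κ k := hd
    _ ≤ A * ((2 + κ (2 * A * C)) * κ (dist o (β.1 t))) := by gcongr
    _ = _ := by ring

/-- A set which fellow travels a `κ`-contracting set has a gauge. -/
theorem IsContracting.exists_isGauge [ProperSpace X] {Z Y : Set X} (hZ : IsClosed Z) (ho : o ∈ Z)
    (hcon : IsContracting κ o Z) (hY : Y.Nonempty) (hYZ : ∃ n, Y ⊆ nbhd κ o Z n)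
    (hZY : ∃ n, Z ⊆ nbhd κ o Y n) : ∃ m : ℝ → ℝ → ℝ, IsGauge κ o Y m := by
  obtain ⟨m₀, hm₀, -, hm₀'⟩ := hcon.exists_gauge hZ ho
  choose m₁ hm₁ using fun q Q : ℝ => nbhd_trans κ o ⟨o, ho⟩
    ⟨m₀ q Q, Subset.rfl (s := nbhd κ o Z (m₀ q Q))⟩ hZY
  obtain ⟨n₁, hn₁⟩ := hYZ
  refine ⟨fun q Q => max (m₀ q Q) (m₁ q Q), fun q Q hq hQ =>
    (hm₀ q Q hq hQ).trans (le_max_left _ _), fun r n κ' hr hn => ?_⟩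
  obtain ⟨ε, hε, R₁, hR₁⟩ := hm₀' r hr
  -- The allowance εR is split in three: the given closeness to Y, the slack 1 in choosing y in Y,
  -- and the distance from y to Z. The bounds `h3` and `h5` keep ‖y‖ ≤ 2R.
  obtain ⟨R, h1, h2, h3, h4, h5, h6⟩ := ((κ'.eventually_mul_le n (ε := ε / 3) (by positivity)).and
    ((κ.eventually_mul_le (2 * |n₁|) (ε := ε / 3) (by positivity)).and
    ((κ'.eventually_mul_le n (ε := 1 / 2) (by positivity)).and
    ((eventually_ge_atTop (3 / ε)).and
    ((eventually_ge_atTop 2).and (eventually_ge_atTop R₁)))))).exists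
  have hR0 : 0 < R := by linarith
  refine ⟨R, hR0, fun q Q η hη hsmall hclose => ?_⟩
  have h7 := hR₁ R h6 q Q η hη ((le_max_left _ _).trans hsmall) ?_
  · exact (h7.trans (hm₁ q Q)).trans (nbhd_mono (le_max_right _ _))
  have hx : dist o (η (firstTime o η R)) = R := hη.dist_firstTime hR0.le
  obtain ⟨y, hy, hxy⟩ := (Metric.infDist_lt_iff hY).1 (hclose.trans_lt (lt_add_one _))
  have h8 : dist o y ≤ 2 * R := by linarith [dist_triangle o (η (firstTime o η R)) y]
  have h9 : Metric.infDist y Z ≤ |n₁| * (2 * κ R) := by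
    have hκy := κ.pos (dist_nonneg (x := o) (y := y))
    have hm : κ (dist o y) ≤ κ (2 * R) :=
      κ.mono (mem_Ici.2 dist_nonneg) (mem_Ici.2 (by positivity)) h8
    calc Metric.infDist y Z ≤ n₁ * κ (dist o y) := hn₁ hy
      _ ≤ |n₁| * κ (dist o y) := by
        gcongr
        exact le_abs_self _
      _ ≤ |n₁| * (2 * κ R) := by
        gcongr
        exact hm.trans (κ.mul_le one_le_two hR0.le)
  have h10 := Metric.infDist_le_infDist_add_dist (s := Z) (x := η (firstTime o η R)) (y := y)
  rw [div_le_iff₀ hε] at h4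
  linarith

theorem Boundary.contains_iff {b : Boundary κ o} {β γ : QuasiGeodesicRay o} (h : b.Contains β) :
    b.Contains γ ↔ FellowTravel κ o β γ := by
  rw [Boundary.Contains, ← show _ = b.1 from h, eq_comm]
  exact Quotient.eq

theorem Boundary.ext_of_contains {a b : Boundary κ o} {β : QuasiGeodesicRay o}
    (ha : a.Contains β) (hb : b.Contains β) : a = b :=
  Subtype.ext ((show _ = a.1 from ha).symm.trans hb)

/-- The geodesic ray itself is never shown to be contracting; its gauge is inherited from the
contracting representative by fellow travelling. -/
theorem IsCAT0.exists_geodesic_isGauge [ProperSpace X] (hX : IsCAT0 X) (b : Boundary κ o) :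
    ∃ β : QuasiGeodesicRay o, β.IsGeodesic ∧ b.Contains β ∧
      ∃ m : ℝ → ℝ → ℝ, IsGauge κ o (range β.1) m := by
  obtain ⟨β₀, hcon, hβ₀⟩ := b.2
  obtain ⟨q, Q, hqg⟩ := β₀.2
  obtain ⟨β, hβ, h⟩ := hX.exists_geodesic_subset_nbhd β₀ hcon
  have h' := hβ.exists_subset_nbhd h
  exact ⟨β, hβ, (Boundary.contains_iff hβ₀).2 ⟨h', h⟩,
    hcon.exists_isGauge hqg.isClosed_range ⟨0, hqg.base⟩ (range_nonempty _) h h'⟩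

theorem IsCAT0.geodesic_unique [ProperSpace X] (hX : IsCAT0 X) {b : Boundary κ o}
    {β γ : QuasiGeodesicRay o} (hβ : β.IsGeodesic) (hb : b.Contains β) (hγ : γ.IsGeodesic)
    (hb' : b.Contains γ) : β = γ := by
  obtain ⟨n, hn⟩ := ((Boundary.contains_iff hb).1 hb').1
  refine hX.eq_of_forall_infDist_le (κ := κ) (n := n) hβ hγ fun t => ?_
  have := hn (mem_range_self t)
  rwa [mem_nbhd, hβ.dist_base] at this

end GeodesicRepresentative

/-! ### Surgery between quasi-geodesic rays -/

section Surgery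

variable {X : Type*} [MetricSpace X] {o : X} {q Q : ℝ}

theorem IsQuasiGeodesicRay.of_le {ρ : ℝ≥0 → X} (hq : 1 ≤ q) (hQ : 0 ≤ Q) (hc : Continuous ρ)
    (h0 : ρ 0 = o)
    (lower : ∀ s t : ℝ≥0, s ≤ t → (t : ℝ) - s ≤ q * (dist (ρ s) (ρ t) + Q))
    (upper : ∀ s t : ℝ≥0, s ≤ t → dist (ρ s) (ρ t) ≤ q * (t - s) + Q) :
    IsQuasiGeodesicRay o q Q ρ := by
  have hd : ∀ s t : ℝ≥0, s ≤ t → dist s t = (t : ℝ) - s := by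
    intro s t hst
    have : (s : ℝ) ≤ t := by exact_mod_cast hst
    rw [NNReal.dist_eq, abs_sub_comm, abs_of_nonneg (sub_nonneg.2 this)]
  have hq0 : 0 < q := by linarith
  have hl : ∀ s t : ℝ≥0, s ≤ t → 1 / q * dist s t - Q ≤ dist (ρ s) (ρ t) := by
    intro s t hst
    have := lower s t hst
    rw [hd s t hst, one_div_mul_eq_div, sub_le_iff_le_add, div_le_iff₀ hq0]
    linarith
  refine ⟨hq, hQ, hc, h0, fun s t => ?_, fun s t => ?_⟩
  · rcases le_total s t with h | h
    · exact hl s t h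
    · rw [dist_comm s, dist_comm (ρ s)]
      exact hl t s h
  · rcases le_total s t with h | h
    · rw [hd s t h]
      exact upper s t h
    · rw [dist_comm s, dist_comm (ρ s), hd t s h]
      exact upper t s h

/-- The tails coincide and the initial pieces are bounded, which suffices because κ ≥ 1. -/
theorem fellowTravel_of_eventually_eq (κ : SublinearFn) {α ρ : QuasiGeodesicRay o}
    (hα : α.IsGeodesic) {u₀ t₀ : ℝ≥0} (h : ∀ v, ρ.1 (t₀ + v) = α.1 (u₀ + v)) :
    FellowTravel κ o α ρ := by
  obtain ⟨q, Q, hρ⟩ := ρ.2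
  have hq := hρ.one_le
  have hQ := hρ.nonneg
  refine ⟨⟨u₀, ?_⟩, q * t₀ + Q, ?_⟩
  · rintro _ ⟨u, rfl⟩
    have hκ := κ.one_le (dist o (α.1 u)) dist_nonneg
    refine le_trans ?_ (le_mul_of_one_le_right u₀.2 hκ)
    rcases le_total u u₀ with hu | hu
    · refine (Metric.infDist_le_dist_of_mem (mem_range.2 ⟨0, ρ.base⟩)).trans ?_
      rw [dist_comm, hα.dist_base]
      exact_mod_cast hu
    · obtain ⟨v, rfl⟩ := exists_add_of_le hu
      rw [← h, Metric.infDist_zero_of_mem (mem_range_self _)]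
      exact u₀.2
  · rintro _ ⟨t, rfl⟩
    have hκ := κ.one_le (dist o (ρ.1 t)) dist_nonneg
    have h0 : 0 ≤ q * t₀ + Q := by positivity
    refine le_trans ?_ (le_mul_of_one_le_right h0 hκ)
    rcases le_total t t₀ with ht | ht
    · refine (Metric.infDist_le_dist_of_mem (mem_range.2 ⟨0, α.base⟩)).trans ?_
      have h1 := hρ.upper t 0
      rw [hρ.base, dist_comm t, nnreal_dist_zero] at h1
      have ht' : (t : ℝ) ≤ t₀ := by exact_mod_cast ht
      have h2 : q * t ≤ q * t₀ := by gcongr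
      linarith
    · obtain ⟨v, rfl⟩ := exists_add_of_le ht
      rw [h, Metric.infDist_zero_of_mem (mem_range_self _)]
      exact h0

/-- A closest pair of points on an initial piece of a quasi-geodesic ray and on a final piece of
a geodesic ray. -/
theorem exists_closest_pair [ProperSpace X] {η : ℝ≥0 → X} (hη : IsQuasiGeodesicRay o q Q η)
    {α : QuasiGeodesicRay o} (hα : α.IsGeodesic) (t₀ u₀ : ℝ≥0) :
    ∃ t₁ ≤ t₀, ∃ u₁ ≥ u₀, ∀ t ≤ t₀, ∀ u ≥ u₀,
      dist (η t₁) (α.1 u₁) ≤ dist (η t) (α.1 u) := by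
  have hA : IsClosed (α.1 '' Ici u₀) :=
    (Isometry.isClosedEmbedding hα).isClosedMap _ isClosed_Ici
  have hne : (α.1 '' Ici u₀).Nonempty := ⟨_, mem_image_of_mem _ (mem_Ici.2 le_rfl)⟩
  obtain ⟨t₁, ht₁, hmin⟩ := (isCompact_Icc (a := 0) (b := t₀)).exists_isMinOn
    ⟨0, le_rfl, zero_le⟩ ((Metric.continuous_infDist_pt (α.1 '' Ici u₀)).comp
      hη.continuous).continuousOn
  obtain ⟨_, ⟨u₁, hu₁, rfl⟩, hd⟩ := hA.exists_infDist_eq_dist hne (η t₁)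
  refine ⟨t₁, ht₁.2, u₁, hu₁, fun t ht u hu => ?_⟩
  rw [← hd]
  exact (hmin ⟨zero_le, ht⟩).trans (Metric.infDist_le_dist_of_mem (mem_image_of_mem _ hu))

/-- A quasi-geodesic ray which is close to a geodesic ray at radius `R` can be redirected to the
geodesic ray close to that radius. -/
theorem IsCAT0.exists_surgery [ProperSpace X] (hX : IsCAT0 X) (κ : SublinearFn) {η : ℝ≥0 → X}
    (hη : IsQuasiGeodesicRay o q Q η) {α : QuasiGeodesicRay o} (hα : α.IsGeodesic) {R D : ℝ}
    (hR : 0 ≤ R) (hD : Metric.infDist (η (firstTime o η R)) (range α.1) ≤ D) :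
    ∃ ρ : QuasiGeodesicRay o, IsQuasiGeodesicRay o (4 * q) Q ρ.1 ∧ FellowTravel κ o α ρ ∧
      ∃ t₁ : ℝ≥0, EqOn ρ.1 η (Iic t₁) ∧ R - 2 * D ≤ dist o (η t₁) := by
  have hq := hη.one_le
  have hQ := hη.nonneg
  have hq0 : 0 < q := by linarith
  set t₀ := firstTime o η R with ht₀
  -- The new ray follows η up to t₁, then a geodesic bridge between the closest pair, then α from
  -- u₁. Starting the tail of α at 3R separates it by at least 2R from the initial piece of η, which
  -- lies in the ball of radius R. It also forces ‖η t₁‖ ≥ 3R - (2R + 2D), as the bridge is no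
  -- longer than 2R + 2D.
  obtain ⟨t₁, ht₁, u₁, hu₁, hmin⟩ := exists_closest_pair hη hα t₀ (3 * R).toNNReal
  have hRR : ((3 * R).toNNReal : ℝ) = 3 * R := Real.coe_toNNReal _ (by positivity)
  have hu₁R : 3 * R ≤ u₁ := by
    rw [← hRR]
    exact_mod_cast hu₁
  have hnorm : ∀ t ≤ t₀, dist o (η t) ≤ R := fun t ht => hη.dist_le_of_le_firstTime hR ht
  have ht₀R : dist o (η t₀) = R := hη.dist_firstTime hR
  obtain ⟨γ, l, hl0, hγ0, hγl, hγ⟩ := hX.geodesic (η t₁) (α.1 u₁)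
  have hl : dist (η t₁) (α.1 u₁) = l := by
    rw [← hγ0, ← hγl, hγ 0 ⟨le_rfl, hl0⟩ l ⟨hl0, le_rfl⟩, zero_sub, abs_neg, abs_of_nonneg hl0]
  have hlarge : R - 2 * D ≤ dist o (η t₁) := by
    have h1 := hmin t₀ le_rfl _ le_rfl
    have h2 := hα.dist_le_two_mul_infDist (η t₀) (t := R.toNNReal)
      (by rw [ht₀R, Real.coe_toNNReal _ hR])
    have h3 : dist (α.1 R.toNNReal) (α.1 (3 * R).toNNReal) = 2 * R := by
      rw [Isometry.dist_eq hα, NNReal.dist_eq, hRR, Real.coe_toNNReal _ hR, abs_sub_comm,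
        abs_of_nonneg (by linarith)]
      ring
    have h4 := dist_triangle (η t₀) (α.1 R.toNNReal) (α.1 (3 * R).toNNReal)
    have h5 := dist_triangle o (η t₁) (α.1 u₁)
    rw [hα.dist_base] at h5
    linarith
  lift l to ℝ≥0 using hl0
  let δ : ℝ≥0 → X := fun v => γ (min v l)
  have hδ : Continuous δ := by
    have hc : ContinuousOn γ (Icc 0 l) :=
      (IsGeodesicSegment.isQuasiGeodesicOn ⟨l.2, hγ0, hγl, hγ⟩).continuousOn
    exact hc.comp_continuous (by fun_prop) fun v => ⟨le_min v.2 l.2, min_le_right _ _⟩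
  let ρ : ℝ≥0 → X := fun t => if t ≤ t₁ then η t else
    if t ≤ t₁ + l then δ (t - t₁) else α.1 (u₁ + (t - (t₁ + l)))
  have hρ1 : ∀ t ≤ t₁, ρ t = η t := fun t ht => if_pos ht
  have hρ2 : ∀ v ≤ l, ρ (t₁ + v) = γ v := by
    intro v hv
    have hvl : min (v : ℝ) l = v := min_eq_left (by exact_mod_cast hv)
    by_cases h : t₁ + v ≤ t₁
    · obtain rfl : v = 0 := by simpa using h
      rw [add_zero, hρ1 _ le_rfl, NNReal.coe_zero, hγ0]
    · simp only [ρ, δ, if_neg h, add_le_add_iff_left, if_pos hv, add_tsub_cancel_left, hvl]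
  have hρ3 : ∀ v, ρ (t₁ + l + v) = α.1 (u₁ + v) := by
    intro v
    by_cases h : t₁ + l + v ≤ t₁ + l
    · obtain rfl : v = 0 := by simpa using h
      rw [add_zero, hρ2 l le_rfl, hγl, add_zero]
    · have h' : ¬t₁ + l + v ≤ t₁ := fun h1 => h (h1.trans le_self_add)
      simp only [ρ, if_neg h, if_neg h', add_tsub_cancel_left]
  have hρc : Continuous ρ := by
    refine Continuous.if_le hη.continuous (Continuous.if_le (by fun_prop) ?_ continuous_id
      continuous_const ?_) continuous_id continuous_const ?_
    · exact (Isometry.continuous hα).comp (by fun_prop)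
    · rintro t rfl
      simp [δ, hγl]
    · rintro t rfl
      simp [δ, hγ0]
  have cases3 : ∀ t : ℝ≥0, t ≤ t₁ ∨ (∃ v ≤ l, t = t₁ + v) ∨ ∃ v, t = t₁ + l + v := by
    intro t
    rcases le_total t t₁ with h | h
    · exact Or.inl h
    obtain ⟨v, rfl⟩ := exists_add_of_le h
    rcases le_total v l with hv | hv
    · exact Or.inr (Or.inl ⟨v, hv, rfl⟩)
    · obtain ⟨w, rfl⟩ := exists_add_of_le hv
      exact Or.inr (Or.inr ⟨w, (add_assoc _ _ _).symm⟩)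
  have hγγ : ∀ a b : ℝ≥0, b ≤ l → a ≤ b → dist (γ a) (γ b) = b - a := by
    intro a b hb hab
    have hb' : (b : ℝ) ≤ l := by exact_mod_cast hb
    have hab' : (a : ℝ) ≤ b := by exact_mod_cast hab
    rw [hγ a ⟨a.2, hab'.trans hb'⟩ b ⟨b.2, hb'⟩, abs_sub_comm, abs_of_nonneg (sub_nonneg.2 hab')]
  have hαα : ∀ a b : ℝ≥0, a ≤ b → dist (α.1 (u₁ + a)) (α.1 (u₁ + b)) = b - a := by
    intro a b hab
    have hab' : (a : ℝ) ≤ b := by exact_mod_cast hab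
    rw [Isometry.dist_eq hα, NNReal.dist_eq, abs_sub_comm, NNReal.coe_add, NNReal.coe_add,
      add_sub_add_left_eq_sub, abs_of_nonneg (sub_nonneg.2 hab')]
  have hγs : ∀ v ≤ l, dist (η t₁) (γ v) = v := by
    intro v hv
    simpa [hγ0] using hγγ 0 v hv zero_le
  have hγe : ∀ v ≤ l, dist (γ v) (α.1 u₁) = l - v := by
    intro v hv
    rw [← hγl, hγγ v l le_rfl hv]
  have hαd : ∀ v : ℝ≥0, dist (α.1 u₁) (α.1 (u₁ + v)) = v := by
    intro v
    simpa using hαα 0 v zero_le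
  have hηl : ∀ s ≤ t₁, (t₁ : ℝ) - s ≤ q * (dist (η s) (η t₁) + Q) := by
    intro s hs
    refine le_trans ?_ (hη.dist_mul_sub_le s t₁)
    rw [NNReal.dist_eq, abs_sub_comm]
    exact le_abs_self _
  have hηu : ∀ s ≤ t₁, dist (η s) (η t₁) ≤ q * (t₁ - s) + Q := by
    intro s hs
    have hs' : (s : ℝ) ≤ t₁ := by exact_mod_cast hs
    have := hη.upper s t₁
    rwa [NNReal.dist_eq, abs_sub_comm, abs_of_nonneg (sub_nonneg.2 hs')] at this
  have hqd : ∀ d : ℝ, 0 ≤ d → d ≤ q * d := fun d hd => le_mul_of_one_le_left hd hq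
  have hqQ := mul_nonneg hq0.le hQ
  have hqg : IsQuasiGeodesicRay o (4 * q) Q ρ := by
    -- For the lower bound, minimality of the bridge prevents cancellation: when the two points lie
    -- on different pieces, the elapsed time is at most 3q times their distance plus qQ. For the
    -- upper bound, only η contributes an additive Q, since the other two pieces have unit speed.
    refine .of_le (by linarith) hQ hρc (by rw [hρ1 0 zero_le, hη.base]) ?_ ?_
    · intro s t hst
      have hqd0 := hqd _ (dist_nonneg (x := ρ s) (y := ρ t))
      have hd0 := dist_nonneg (x := ρ s) (y := ρ t)
      rcases hst.eq_or_lt with rfl | hlt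
      · rw [sub_self]
        positivity
      rcases cases3 s with hs | ⟨a, ha, rfl⟩ | ⟨a, rfl⟩ <;>
        rcases cases3 t with ht | ⟨b, hb, rfl⟩ | ⟨b, rfl⟩
      · rw [hρ1 s hs, hρ1 t ht] at hqd0 hd0 ⊢
        have h1 := hη.dist_mul_sub_le s t
        rw [NNReal.dist_eq, abs_sub_comm] at h1
        have h2 := le_abs_self ((t : ℝ) - s)
        have := mul_nonneg hq0.le (dist_nonneg (x := η s) (y := η t))
        linarith
      · rw [hρ1 s hs, hρ2 b hb] at hqd0 hd0 ⊢
        have h1 := hmin s (hs.trans ht₁) u₁ hu₁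
        have h2 := dist_triangle (η s) (γ b) (α.1 u₁)
        have h3 := dist_triangle_right (η s) (η t₁) (γ b)
        rw [hγs b hb] at h3
        rw [hγe b hb] at h2
        have h4 : q * (dist (η s) (η t₁) + Q) ≤ q * (2 * dist (η s) (γ b) + Q) := by
          gcongr
          linarith
        have h5 := hηl s hs
        push_cast
        linarith
      · rw [hρ1 s hs, hρ3 b] at hqd0 hd0 ⊢
        have h1 := hmin s (hs.trans ht₁) (u₁ + b) (le_add_right hu₁)
        have h2 := dist_triangle o (η s) (α.1 (u₁ + b))
        rw [hα.dist_base] at h2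
        push_cast at h2 ⊢
        have h3 := hnorm s (hs.trans ht₁)
        have h4 := hnorm t₁ ht₁
        have h5 := dist_triangle_left (η s) (η t₁) o
        have hb0 : (0 : ℝ) ≤ b := b.2
        have h6 : q * (dist (η s) (η t₁) + Q) ≤ q * (dist (η s) (α.1 (u₁ + b)) + Q) := by
          gcongr
          linarith
        have h7 := hηl s hs
        linarith
      · exact absurd (hlt.trans_le ht) (not_lt.2 le_self_add)
      · rw [hρ2 a ha, hρ2 b hb, hγγ a b hb (by simpa using hst)] at hqd0 hd0 ⊢
        push_cast
        linarith
      · rw [hρ2 a ha, hρ3 b] at hqd0 hd0 ⊢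
        have h1 := hmin t₁ ht₁ (u₁ + b) (le_add_right hu₁)
        have h2 := dist_triangle (η t₁) (γ a) (α.1 (u₁ + b))
        have h3 := dist_triangle_left (α.1 u₁) (α.1 (u₁ + b)) (γ a)
        rw [hαd, hγe a ha] at h3
        rw [hγs a ha] at h2
        push_cast
        linarith
      · exact absurd (hlt.trans_le ht) (not_lt.2 (le_add_right le_self_add))
      · have h1 := hlt.trans_le (add_le_add_right hb t₁)
        exact absurd h1 (not_lt.2 le_self_add)
      · rw [hρ3 a, hρ3 b, hαα a b (by simpa using hst)] at hqd0 hd0 ⊢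
        push_cast
        linarith
    · intro s t hst
      rcases hst.eq_or_lt with rfl | hlt
      · rw [dist_self, sub_self, mul_zero, zero_add]
        exact hQ
      have hst' : (s : ℝ) ≤ t := by exact_mod_cast hst
      rcases cases3 s with hs | ⟨a, ha, rfl⟩ | ⟨a, rfl⟩ <;>
        rcases cases3 t with ht | ⟨b, hb, rfl⟩ | ⟨b, rfl⟩
      · rw [hρ1 s hs, hρ1 t ht]
        have h1 := hη.upper s t
        rw [NNReal.dist_eq, abs_sub_comm, abs_of_nonneg (sub_nonneg.2 hst')] at h1
        have := mul_nonneg hq0.le (sub_nonneg.2 hst')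
        linarith
      · rw [hρ1 s hs, hρ2 b hb]
        have h1 := dist_triangle (η s) (η t₁) (γ b)
        rw [hγs b hb] at h1
        have h2 := hqd b b.2
        have h3 := hηu s hs
        have h4 := hq0.le
        have h5 : (s : ℝ) ≤ t₁ := by exact_mod_cast hs
        have h6 := mul_nonneg hq0.le (sub_nonneg.2 h5)
        have h7 : (0 : ℝ) ≤ b := b.2
        push_cast
        linarith
      · rw [hρ1 s hs, hρ3 b]
        have h1 := dist_triangle4 (η s) (η t₁) (α.1 u₁) (α.1 (u₁ + b))
        rw [hl, hαd] at h1
        have h2 := hqd b b.2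
        have h3 := hηu s hs
        have h4 := hqd l l.2
        have h5 : (s : ℝ) ≤ t₁ := by exact_mod_cast hs
        have h6 := mul_nonneg hq0.le (sub_nonneg.2 h5)
        have h7 : (0 : ℝ) ≤ b := b.2
        have h8 : (0 : ℝ) ≤ l := l.2
        push_cast
        linarith
      · exact absurd (hlt.trans_le ht) (not_lt.2 le_self_add)
      · have h1 : a ≤ b := by simpa using hst
        rw [hρ2 a ha, hρ2 b hb, hγγ a b hb h1]
        have h2 : (a : ℝ) ≤ b := by exact_mod_cast h1
        have h3 := hqd _ (sub_nonneg.2 h2)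
        push_cast
        linarith
      · rw [hρ2 a ha, hρ3 b]
        have h1 := dist_triangle (γ a) (α.1 u₁) (α.1 (u₁ + b))
        rw [hγe a ha, hαd] at h1
        have h2 : (a : ℝ) ≤ l := by exact_mod_cast ha
        have h3 := hqd _ (sub_nonneg.2 h2)
        have h4 := hqd b b.2
        have h5 : (0 : ℝ) ≤ b := b.2
        push_cast
        linarith
      · exact absurd (hlt.trans_le ht) (not_lt.2 (le_add_right le_self_add))
      · have h1 := hlt.trans_le (add_le_add_right hb t₁)
        exact absurd h1 (not_lt.2 le_self_add)
      · have h1 : a ≤ b := by simpa using hst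
        rw [hρ3 a, hρ3 b, hαα a b h1]
        have h2 : (a : ℝ) ≤ b := by exact_mod_cast h1
        have h3 := hqd _ (sub_nonneg.2 h2)
        push_cast
        linarith
  exact ⟨⟨ρ, _, _, hqg⟩, hqg, fellowTravel_of_eventually_eq κ hα hρ3, t₁, hρ1, hlarge⟩

end Surgery

/-! ### The visual topology -/

section Topology

variable {X : Type*} [MetricSpace X] {o : X} {κ : SublinearFn}
  {m : Boundary κ o → ℝ → ℝ → ℝ} {q Q : ℝ}

theorem firstTime_mem_initialPiece {α : ℝ≥0 → X} (hα : IsQuasiGeodesicRay o q Q α) {r r' : ℝ}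
    (hr : 0 ≤ r) (hrr' : r ≤ r') : α (firstTime o α r) ∈ initialPiece o α r' :=
  mem_image_of_mem _ ⟨zero_le, firstTime_mono hα hr hrr'⟩

/-- If the constants of a quasi-geodesic ray have a gauge that is small compared to `r`, then they
are themselves bounded in terms of `r`. -/
theorem IsGauge.isQuasiGeodesicRay_max {Z : Set X} {μ : ℝ → ℝ → ℝ} (hμ : IsGauge κ o Z μ)
    {α : ℝ≥0 → X} (hα : IsQuasiGeodesicRay o q Q α) {r P : ℝ} (hr : 0 < r)
    (hs : IsSmall κ (μ q Q) r) (hP : r ≤ P) : IsQuasiGeodesicRay o P P α := by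
  have h := (hμ.1 q Q hα.one_le hα.nonneg).trans ((hs.le hr).trans hP)
  exact hα.mono ((le_max_left _ _).trans h) ((le_max_right _ _).trans h)

/-- Rays in the class fellow travel the geodesic ray, so the gauge applies with the function κ
itself and the fellow travelling constant. -/
theorem IsGaugeFamily.mem_U_self (hm : IsGaugeFamily m) (b : Boundary κ o) {r : ℝ} (hr : 0 < r) :
    b ∈ U m b r := by
  intro β hβ hb q Q α hα hbα hs
  obtain ⟨n, hn⟩ := ((Boundary.contains_iff hb).1 hbα).2
  obtain ⟨R, hR, h⟩ := (hm b β hβ hb).2 r (max n 1) κ hr (by positivity)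
  refine h q Q α.1 hα hs ?_
  have h1 := nbhd_mono (le_max_left n 1) (hn (mem_range_self (firstTime o α.1 R)))
  rwa [mem_nbhd, hα.dist_firstTime hR.le] at h1

variable [ProperSpace X]

/-- Quasi-geodesic rays that can be redirected to points of `U m b r'` at a radius beyond `r'`
are close to the geodesic ray in `b` up to the radius `r`. -/
theorem IsGaugeFamily.exists_redirect (hX : IsCAT0 X) (hm : IsGaugeFamily m) (b : Boundary κ o)
    {r : ℝ} (hr : 0 < r) : ∃ r' : ℝ, 0 < r' ∧ ∀ a ∈ U m b r', ∀ α : QuasiGeodesicRay o,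
      α.IsGeodesic → a.Contains α → ∀ (q Q : ℝ) (η : ℝ≥0 → X), IsQuasiGeodesicRay o q Q η →
        IsSmall κ (m b q Q) r → ∀ R D : ℝ, 0 ≤ R → r' ≤ R - 2 * D →
          Metric.infDist (η (firstTime o η R)) (range α.1) ≤ D →
            ∀ β : QuasiGeodesicRay o, β.IsGeodesic → b.Contains β →
              initialPiece o η r ⊆ nbhd κ o (range β.1) (m b q Q) := by
  obtain ⟨β, hβ, hb, -⟩ := hX.exists_geodesic_isGauge b
  have hg := hm b β hβ hb
  set P := max 1 r with hP
  have hP1 : 1 ≤ P := le_max_left _ _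
  set N := m b (4 * P) P with hN
  have hN0 : 0 < N := by
    have h1 := (le_max_left _ _).trans (hg.1 (4 * P) P (by linarith) (by linarith))
    linarith
  -- N is the gauge at the constants (4P, P) of a redirected ray, and R₀ is the radius at which
  -- N-closeness must be tested. Membership in U(b, r') supplies this closeness for the redirected
  -- ray; as r' ≥ R₀, that ray still agrees with η there.
  obtain ⟨R₀, hR₀, hR⟩ := hg.2 r N κ hr hN0
  obtain ⟨r', hs', hr'⟩ := ((κ.eventually_isSmall N).and (eventually_ge_atTop R₀)).exists
  refine ⟨r', hR₀.trans_le hr', fun a ha α hα haα q Q η hη hs R D hR0 hRD hD β' hβ' hb' => ?_⟩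
  obtain rfl := hX.geodesic_unique hβ hb hβ' hb'
  have hηP := hg.isQuasiGeodesicRay_max hη hr hs (le_max_right 1 r)
  obtain ⟨ρ, hρ, hft, t₁, heq, ht₁⟩ := hX.exists_surgery κ hηP hα hR0 hD
  have haρ := (Boundary.contains_iff haα).2 hft
  have hRt : R₀ ≤ dist o (η t₁) := hr'.trans (hRD.trans ht₁)
  have hfirst := hη.firstTime_eq_of_eqOn hρ heq hR₀.le hRt
  refine hR q Q η hη hs ?_
  have h1 := ha β hβ hb _ _ ρ hρ haρ hs' (firstTime_mem_initialPiece hρ hR₀.le hr')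
  rw [hfirst, heq (mem_Iic.2 (hη.firstTime_le hR₀.le hRt)), mem_nbhd,
    hη.dist_firstTime hR₀.le] at h1
  exact h1

/-! ### Neighbourhood basis and separation -/

/-- This is the neighbourhood axiom. A ray whose class is near a is sublinearly close at a large
radius R to the geodesic ray α of a, so it can be redirected to α beyond radius r'. -/
theorem IsGaugeFamily.exists_U_subset (hX : IsCAT0 X) (hm : IsGaugeFamily m) (b : Boundary κ o)
    {r : ℝ} (hr : 0 < r) : ∃ r' : ℝ, 0 < r' ∧ ∀ a ∈ U m b r', ∃ r'' : ℝ, 0 < r'' ∧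
      U m a r'' ⊆ U m b r := by
  obtain ⟨r', hr', h⟩ := hm.exists_redirect hX b hr
  refine ⟨r', hr', fun a ha => ?_⟩
  obtain ⟨α, hα, haα, -⟩ := hX.exists_geodesic_isGauge a
  set P := max 1 r with hP
  obtain ⟨R, h1, h2, h3⟩ := ((κ.eventually_mul_le (2 * m a P P) (ε := 1 / 2) (by positivity)).and
    ((eventually_ge_atTop (2 * r')).and (κ.eventually_isSmall (m a P P)))).exists
  have hR : 0 < R := by linarith
  refine ⟨R, hR, fun a' ha' β hβ hb q Q η hη haη hs => ?_⟩
  have hηP := (hm b β hβ hb).isQuasiGeodesicRay_max hη hr hs (le_max_right 1 r)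
  have h4 := ha' α hα haα P P η hηP haη h3 (firstTime_mem_initialPiece hη hR.le le_rfl)
  rw [mem_nbhd, hη.dist_firstTime hR.le] at h4
  exact h a ha α hα haα q Q η.1 hη hs R (m a P P * κ R) hR.le (by linarith) h4 β hβ hb

theorem IsGaugeFamily.nhds_hasBasis (hX : IsCAT0 X) (hm : IsGaugeFamily m) (b : Boundary κ o) :
    (@nhds _ (visualTopology m) b).HasBasis (fun r : ℝ => 0 < r) (fun r => U m b r) := by
  let := visualTopology m
  refine ⟨fun s => ⟨fun hs => ?_, ?_⟩⟩
  · obtain ⟨t, hts, ht, hbt⟩ := mem_nhds_iff.1 hs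
    obtain ⟨r, hr, h⟩ := ht b hbt
    exact ⟨r, hr, h.trans hts⟩
  · rintro ⟨r, hr, hrs⟩
    -- The candidate for the interior of U(b, r); the neighbourhood axiom makes it open.
    refine mem_nhds_iff.2 ⟨{a | ∃ s : ℝ, 0 < s ∧ U m a s ⊆ U m b r}, ?_, ?_, r, hr, Subset.rfl⟩
    · rintro a ⟨s, hs, h⟩
      exact hrs (h (hm.mem_U_self a hs))
    · rintro a ⟨s, hs, h⟩
      obtain ⟨s', hs', h'⟩ := hm.exists_U_subset hX a hs
      refine ⟨s', hs', fun a' ha' => ?_⟩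
      obtain ⟨s'', hs'', h''⟩ := h' a' ha'
      exact ⟨s'', hs'', h''.trans h⟩

theorem IsGaugeFamily.t0Space (hX : IsCAT0 X) (hm : IsGaugeFamily m) :
    @T0Space _ (visualTopology m) := by
  let := visualTopology m
  refine (t0Space_iff_inseparable _).2 fun a b hab => ?_
  have hmem : ∀ r : ℝ, 0 < r → a ∈ U m b r := fun r hr =>
    mem_of_mem_nhds (hab.nhds_eq ▸ (hm.nhds_hasBasis hX b).mem_of_mem hr)
  obtain ⟨α, hα, ha, -⟩ := hX.exists_geodesic_isGauge a
  obtain ⟨β, hβ, hb, -⟩ := hX.exists_geodesic_isGauge b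
  have : α = β := by
    refine hX.eq_of_forall_infDist_le (κ := κ) (n := m b 1 0) hα hβ fun t => ?_
    obtain ⟨r, hs, hr, hr0⟩ := ((κ.eventually_isSmall (m b 1 0)).and
      ((eventually_ge_atTop (t : ℝ)).and (eventually_gt_atTop 0))).exists
    have h := hmem r hr0 β hβ hb 1 0 α hα.isQuasiGeodesicRay ha hs
      (firstTime_mem_initialPiece hα.isQuasiGeodesicRay t.coe_nonneg hr)
    rwa [hα.firstTime, mem_nbhd, hα.dist_base] at h
  subst this
  exact Boundary.ext_of_contains ha hb

/-- The closure of U(b, r') lies in U(b, r). For a in the closure, choose a' in U(b, r') so close to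
a that, at a large radius R, both a given ray η in a and the geodesic ray of a' are close to that of
a. Then η can be redirected to the geodesic ray of a'. -/
theorem IsGaugeFamily.regularSpace (hX : IsCAT0 X) (hm : IsGaugeFamily m) :
    @RegularSpace _ (visualTopology m) := by
  let := visualTopology m
  refine .of_exists_mem_nhds_isClosed_subset fun b s hs => ?_
  obtain ⟨r, hr, hrs⟩ := (hm.nhds_hasBasis hX b).mem_iff.1 hs
  obtain ⟨r', hr', h⟩ := hm.exists_redirect hX b hr
  refine ⟨closure (U m b r'), mem_of_superset ((hm.nhds_hasBasis hX b).mem_of_mem hr')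
    subset_closure, isClosed_closure, Subset.trans (fun a ha => ?_) hrs⟩
  intro β hβ hb q Q η hη haη hs
  obtain ⟨α, hα, haα, -⟩ := hX.exists_geodesic_isGauge a
  set P := max 1 r with hP
  have hηP := (hm b β hβ hb).isQuasiGeodesicRay_max hη hr hs (le_max_right 1 r)
  set n := m a 1 0 + m a P P with hn
  obtain ⟨R, h1, h2, h3, h4⟩ := ((κ.eventually_mul_le (4 * n) (ε := 1 / 2) (by positivity)).and
    ((eventually_ge_atTop (2 * r')).and ((κ.eventually_isSmall (m a P P)).and
      (κ.eventually_isSmall (m a 1 0))))).exists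
  have hR : 0 < R := by linarith
  have hRR : (R.toNNReal : ℝ) = R := Real.coe_toNNReal _ hR.le
  obtain ⟨a', ha'b, ha'a⟩ := (mem_closure_iff_nhds_basis (hm.nhds_hasBasis hX a)).1 ha R hR
  obtain ⟨α', hα', ha'α', -⟩ := hX.exists_geodesic_isGauge a'
  have h5 := hm.mem_U_self a hR α hα haα P P η hηP haη h3
    (firstTime_mem_initialPiece hη hR.le le_rfl)
  rw [mem_nbhd, hη.dist_firstTime hR.le] at h5
  have h6 := ha'a α hα haα 1 0 α' hα'.isQuasiGeodesicRay ha'α' h4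
    (firstTime_mem_initialPiece hα'.isQuasiGeodesicRay hR.le le_rfl)
  rw [← hRR, hα'.firstTime, mem_nbhd, hα'.dist_base, hRR] at h6
  have h7 := hα.dist_le_two_mul_infDist (t := R.toNNReal) (η.1 (firstTime o η.1 R))
    (by rw [hη.dist_firstTime hR.le, hRR])
  have h8 := hα.dist_le_two_mul_infDist (α'.1 R.toNNReal) (hα'.dist_base _)
  have h9 := dist_triangle_right (η.1 (firstTime o η.1 R)) (α'.1 R.toNNReal) (α.1 R.toNNReal)
  refine h a' ha'b α' hα' ha'α' q Q η.1 hη hs R (2 * n * κ R) hR.le (by linarith) ?_ β hβ hb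
  refine (Metric.infDist_le_dist_of_mem (mem_range_self R.toNNReal)).trans ?_
  rw [hn]
  linarith

/-! ### Second countability and metrizability -/

theorem exists_finset_net {Y : Type*} [MetricSpace Y] {x : ℕ → Y} (hx : DenseRange x)
    {K : Set Y} (hK : IsCompact K) : ∃ F : Finset ℕ, (∀ i ∈ F, ∃ y ∈ K, dist y (x i) < 1) ∧
      ∀ y ∈ K, ∃ i ∈ F, dist y (x i) < 1 := by
  classical
  obtain ⟨F, hF⟩ := hK.elim_finite_subcover (fun i => Metric.ball (x i) 1)
    (fun i => Metric.isOpen_ball) fun y _ => mem_iUnion.2 (hx.exists_dist_lt y one_pos)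
  refine ⟨F.filter fun i => ∃ y ∈ K, dist y (x i) < 1, fun i hi => (Finset.mem_filter.1 hi).2,
    fun y hy => ?_⟩
  obtain ⟨i, hi, hyi⟩ := mem_iUnion₂.1 (hF hy)
  exact ⟨i, Finset.mem_filter.2 ⟨hi, y, hy, hyi⟩, hyi⟩

/-- Any bounded piece of a geodesic ray is approximated by a finite subset of a dense sequence. -/
theorem QuasiGeodesicRay.IsGeodesic.exists_finset_infDist {β : QuasiGeodesicRay o}
    (hβ : β.IsGeodesic) {x : ℕ → X} (hx : DenseRange x) {s : ℝ} (hs : 0 ≤ s) :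
    ∃ F : Finset ℕ, ∀ y : X,
      Metric.infDist y (range β.1) ≤ Metric.infDist y (x '' F) + 1 ∧
      (dist o y ≤ s → Metric.infDist y (x '' F) ≤ Metric.infDist y (range β.1) + 1) := by
  obtain ⟨F, hF, hF'⟩ := exists_finset_net hx
    ((isCompact_Icc (a := 0) (b := (2 * s).toNNReal)).image hβ.isQuasiGeodesicRay.continuous)
  refine ⟨F, fun y => ⟨?_, fun hy => ?_⟩⟩
  · obtain ⟨i₀, hi₀, -⟩ := hF' (β.1 0) (mem_image_of_mem _ ⟨le_rfl, zero_le⟩)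
    have hfin : (x '' F).Finite := F.finite_toSet.image x
    obtain ⟨_, ⟨i, hi, rfl⟩, hd⟩ := hfin.isCompact.exists_infDist_eq_dist
      ⟨_, mem_image_of_mem x (Finset.mem_coe.2 hi₀)⟩ y
    obtain ⟨_, ⟨u, -, rfl⟩, hz⟩ := hF i (Finset.mem_coe.1 hi)
    have h1 := Metric.infDist_le_dist_of_mem (x := y) (mem_range_self (f := β.1) u)
    have h2 := dist_triangle_right y (β.1 u) (x i)
    linarith
  · obtain ⟨_, ⟨u, rfl⟩, hd⟩ := hβ.isQuasiGeodesicRay.isClosed_range.exists_infDist_eq_dist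
      (range_nonempty _) y
    have h1 : Metric.infDist y (range β.1) ≤ dist y o :=
      Metric.infDist_le_dist_of_mem (mem_range.2 ⟨0, β.base⟩)
    have h2 := (abs_le.1 (hβ.abs_sub_le y u)).1
    rw [dist_comm] at h1
    -- A nearest point on the ray to a point of norm at most s has parameter at most 2s, which is
    -- why the net covers the ray up to 2s.
    have hu : u ≤ (2 * s).toNNReal := by
      rw [← NNReal.coe_le_coe, Real.coe_toNNReal _ (by positivity)]
      linarith
    obtain ⟨i, hi, hi'⟩ := hF' (β.1 u) (mem_image_of_mem _ ⟨zero_le, hu⟩)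
    have h3 := Metric.infDist_le_dist_of_mem (x := y)
      (mem_image_of_mem x (Finset.mem_coe.2 hi))
    have h4 := dist_triangle y (β.1 u) (x i)
    linarith

theorem IsGaugeFamily.secondCountableTopology (hX : IsCAT0 X) (hm : IsGaugeFamily m) :
    @SecondCountableTopology _ (visualTopology m) := by
  let := visualTopology m
  have : Nonempty X := ⟨o⟩
  let x := TopologicalSpace.denseSeq X
  have hx : DenseRange x := TopologicalSpace.denseRange_denseSeq X
  -- The index consists of a finite set F, a constant P for both q and Q, a neighbourhood size n and
  -- a radius s. With F approximating the geodesic ray of b up to radius s, one gets U(b, s) ⊆ W ⊆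
  -- U(b, r): the approximation error 1 is absorbed because κ ≥ 1, and the second inclusion uses the
  -- gauge at a radius R ≤ s. The sets W need not be open, so their interiors form the basis.
  let W : Finset ℕ × ℕ × ℕ × ℕ → Set (Boundary κ o) := fun i =>
    {a | ∀ α : QuasiGeodesicRay o, IsQuasiGeodesicRay o i.2.1 i.2.1 α.1 → a.Contains α →
      initialPiece o α.1 i.2.2.2 ⊆ nbhd κ o (x '' i.1) i.2.2.1}
  have hW : TopologicalSpace.IsTopologicalBasis (range fun i => interior (W i)) := by
    refine TopologicalSpace.isTopologicalBasis_of_isOpen_of_nhds ?_ fun b u hbu hu => ?_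
    · rintro _ ⟨i, rfl⟩
      exact isOpen_interior
    obtain ⟨r, hr, hru⟩ := hu b hbu
    obtain ⟨β, hβ, hb, -⟩ := hX.exists_geodesic_isGauge b
    have hg := hm b β hβ hb
    obtain ⟨P, hP⟩ := exists_nat_ge r
    obtain ⟨n, hn⟩ := exists_nat_ge (m b P P + 1)
    obtain ⟨R, hR, hgR⟩ := hg.2 r (n + 1) κ hr (by positivity)
    obtain ⟨s, hs1, hs2⟩ := ((tendsto_natCast_atTop_atTop (R := ℝ)).eventually
      ((κ.eventually_isSmall (m b P P)).and (eventually_ge_atTop R))).exists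
    have hs0 : (0 : ℝ) < s := hR.trans_le hs2
    obtain ⟨F, hF⟩ := hβ.exists_finset_infDist hx hs0.le
    refine ⟨_, ⟨(F, P, n, s), rfl⟩, ?_, interior_subset.trans (Subset.trans (fun a ha => ?_) hru)⟩
    · refine mem_interior_iff_mem_nhds.2 (mem_of_superset
        ((hm.nhds_hasBasis hX b).mem_of_mem hs0) fun a ha α hα haα => ?_)
      rintro _ ⟨t, ht, rfl⟩
      have h1 := ha β hβ hb P P α hα haα hs1 (mem_image_of_mem _ ht)
      have h2 := (hF (α.1 t)).2 (hα.dist_le_of_le_firstTime hs0.le ht.2)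
      have hκ := κ.one_le (dist o (α.1 t)) dist_nonneg
      rw [mem_nbhd] at h1 ⊢
      have h3 : (m b P P + 1) * κ (dist o (α.1 t)) ≤ n * κ (dist o (α.1 t)) := by gcongr
      change _ ≤ (n : ℝ) * _
      linarith
    · intro β' hβ' hb' q Q α hα haα hs
      obtain rfl := hX.geodesic_unique hβ hb hβ' hb'
      refine hgR q Q α.1 hα hs ?_
      have h1 := ha α (hg.isQuasiGeodesicRay_max hα hr hs hP) haα
        (firstTime_mem_initialPiece hα hR.le hs2)
      rw [mem_nbhd, hα.dist_firstTime hR.le] at h1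
      change _ ≤ (n : ℝ) * _ at h1
      have h2 := (hF (α.1 (firstTime o α.1 R))).1
      have h3 := κ.one_le R hR.le
      change _ ≤ Metric.infDist _ (x '' F) + 1 at h2
      linarith
  exact hW.secondCountableTopology (countable_range _)

/-- Urysohn's metrization theorem; T0 together with regularity gives T3. -/
theorem IsGaugeFamily.metrizableSpace (hX : IsCAT0 X) (hm : IsGaugeFamily m) :
    @TopologicalSpace.MetrizableSpace _ (visualTopology m) := by
  let := visualTopology m
  have := hm.t0Space hX
  have := hm.regularSpace hX
  have := hm.secondCountableTopology hX
  infer_instance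

theorem IsCAT0.existsUnique_geodesic (hX : IsCAT0 X) (b : Boundary κ o) :
    ∃! β : QuasiGeodesicRay o, β.IsGeodesic ∧ b.Contains β := by
  obtain ⟨β, hβ, hb, -⟩ := hX.exists_geodesic_isGauge b
  exact ⟨β, ⟨hβ, hb⟩, fun γ hγ => hX.geodesic_unique hγ.1 hγ.2 hβ hb⟩

theorem IsCAT0.exists_isGaugeFamily (hX : IsCAT0 X) (κ : SublinearFn) (o : X) :
    ∃ m : Boundary κ o → ℝ → ℝ → ℝ, IsGaugeFamily m := by
  choose β hβ hb m hm using hX.exists_geodesic_isGauge (κ := κ) (o := o)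
  refine ⟨m, fun b γ hγ hbγ => ?_⟩
  rw [← hX.geodesic_unique (hβ b) (hb b) hγ hbγ]
  exact hm b

end Topology

end KappaMorse

theorem theorem4p8 {X : Type*} [MetricSpace X] [ProperSpace X] (hX : KappaMorse.IsCAT0 X)
    (o : X) (κ : KappaMorse.SublinearFn) :
    (∀ b : KappaMorse.Boundary κ o,
      ∃! β : KappaMorse.QuasiGeodesicRay o, β.IsGeodesic ∧ b.Contains β) ∧
    (∃ m : KappaMorse.Boundary κ o → ℝ → ℝ → ℝ, KappaMorse.IsGaugeFamily m) ∧
    ∀ m : KappaMorse.Boundary κ o → ℝ → ℝ → ℝ, KappaMorse.IsGaugeFamily m →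
      (∀ b : KappaMorse.Boundary κ o,
        (@nhds _ (KappaMorse.visualTopology m) b).HasBasis (fun r : ℝ => 0 < r)
          (fun r => KappaMorse.U m b r)) ∧
      @TopologicalSpace.MetrizableSpace _ (KappaMorse.visualTopology m) :=
  ⟨hX.existsUnique_geodesic, hX.exists_isGaugeFamily κ o,
    fun _ hm => ⟨hm.nhds_hasBasis hX, hm.metrizableSpace hX⟩⟩
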